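/- Let $G$ be a finitely generated group and $(Q_n)_{n\in\mathbb N}$ a sequence of finite subsets of $G$ which is (i) a Følner sequence: $|SQ_n\setminus Q_n|/|Q_n|\to 0$ for every finite $S\subset G$ (so $G$ is amenable); (ii) tempered: for some $C>0$, $\bigl|\bigcup_{k<n}Q_k^{-1}Q_n\bigr|\le C|Q_n|$ for all $n$; (iii) strictly increasing: $|Q_n|<|Q_{n+1}|$ for all $n$; (iv) a sequence of monotiles: for each $n$ there is $T\subset G$ such that $G$ is the disjoint union of the sets $Q_nt$, $t\in T$. Let $p\in\ell^1(G)$ satisfy $0\le p(x)\le 1$ and $p(x)=p(x^{-1})$ for all $x\in G$. Let $E$ be the set of unordered pairs $[x,y]$ of distinct elements of $G$, and let $\mathbb P$ be the product measure on $\Omega=\{0,1\}^E$ with $\mathbb P(\omega([x,y])=1)=p(xy^{-1})$. Let $\Gamma_\omega$ be the graph with vertex set $G$ and edge set $\{e\in E:\omega(e)=1\}$. If $\Gamma_\omega$ is locally finite, let $m_\omega(x)$ be the degree of $x$ in $\Gamma_\omega$, and let $\Delta_\omega$ be the Laplacian, $\Delta_\omega f(x)=m_\omega(x)f(x)-\sum_{y:[x,y]\in\Gamma_\omega}f(y)$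 on finitely supported $f:G\to\mathbb C$. For finite $Q\subset G$ let $\Delta_\omega[Q]=p_Q\Delta_\omega i_Q$ on $\ell^2(Q)$, where $i_Q$ is extension by zero and $p_Q$ is restriction to $Q$. For a finite graph $S=(V_S,E_S)$ with $V_S\subset G$ let $\Delta_Sf(x)=\sum_{y:[x,y]\in E_S}(f(x)-f(y))$ on $\ell^2(V_S)$. For a self-adjoint operator $A$ on a finite-dimensional Hilbert space, $n(A)(\lambda)$ denotes the number of eigenvalues of $A$, counted with multiplicity, not exceeding $\lambda\in\mathbb R$. Let $\mathcal S(Q)$ be the set of all graphs with vertex set $Q$, and for a finite graph $S$ with $V_S\subset G$ set $$\nu_S=\prod_{[x,y]\in E_S}p(xy^{-1})\cdot\prod_{x,y\in V_S,\ x\ne y,\ [x,y]\notin E_S}\bigl(1-p(xy^{-1})\bigr),$$ each product running over unordered pairs. Then there is a (non-random) distribution function $N:\mathbb R\to[0,1]$ (non-decreasing, right-continuous, with limits $0$ at $-\infty$ and $1$ at $+\infty$), called the integrated density of states, such that for $\mathbb P$-almost every $\omega$ the graph $\Gamma_\omega$ is locally finite and $$\lim_{j\to\infty}\Bigl\|\frac{n(\Delta_\omega[Q_j])}{|Q_j|}-N\Bigr\|_\infty=0,$$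 and such that $$\lim_{n\to\infty}\Bigl\|\sum_{S\in\mathcal S(Q_n)}\nu_S\,\frac{n(\Delta_S)}{|Q_n|}-N\Bigr\|_\infty=0 .$$ Moreover, the numbers $\nu_S$ are the pattern frequencies along $(Q_n)$: for almost every $\omega$ and every finite graph $S$ with $\emptyset\ne V_S\subset G$, $$\nu_S=\lim_{j\to\infty}\frac{1}{|Q_j|}\bigl|\{x\in G: V_Sx\subset Q_j,\ \Gamma_\omega[V_Sx]=Sx\}\bigr| ,$$ where $\Gamma_\omega[V_Sx]$ is the induced subgraph and $Sx$ the right translate of $S$ by $x$. -/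

import Mathlib

open MeasureTheory ProbabilityTheory Filter Topology
open scoped Pointwise

noncomputable section

namespace LongRangePercolation

/-! ### Sequences of finite subsets of a group -/

/-- `(Q n)` is a Følner sequence: `|S Q_n \ Q_n| / |Q_n| → 0` for every finite `S ⊆ G`. -/
def IsFolner {G : Type*} [Group G] (Q : ℕ → Finset G) : Prop :=
  ∀ S : Finset G, Tendsto
    (fun n => ((((S : Set G) * (Q n : Set G)) \ (Q n : Set G)).ncard : ℝ) / ((Q n).card : ℝ))
    atTop (𝓝 0)

/-- `(Q n)` is tempered: there is `C > 0` with `|⋃_{k < n} Q_k⁻¹ Q_n| ≤ C |Q_n|` for all `n`. -/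
def IsTempered {G : Type*} [Group G] (Q : ℕ → Finset G) : Prop :=
  ∃ C : ℝ, 0 < C ∧ ∀ n : ℕ,
    ((⋃ k ∈ Set.Iio n, (Q k : Set G)⁻¹ * (Q n : Set G)).ncard : ℝ) ≤ C * ((Q n).card : ℝ)

/-- `Q` is a monotile: `G` is the disjoint union of the translates `Q t`, `t ∈ T`, for some
`T ⊆ G`. -/
def IsMonotile {G : Type*} [Group G] (Q : Finset G) : Prop :=
  ∃ T : Set G, T.PairwiseDisjoint (fun t => (Q : Set G) * {t}) ∧
    (⋃ t ∈ T, (Q : Set G) * {t}) = Set.univ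

/-! ### The percolation model -/

/-- The edges of the complete graph with vertex set `G`: unordered pairs of distinct elements. -/
abbrev Edge (G : Type*) := {e : Sym2 G // ¬ e.IsDiag}

/-- The parameter `p ∈ ℓ¹(G)` of the model, with `0 ≤ p ≤ 1` and `p(x⁻¹) = p(x)`. -/
structure EdgeParameter (G : Type*) [Group G] where
  /-- the underlying function -/
  p : G → ℝ
  nonneg : ∀ x, 0 ≤ p x
  le_one : ∀ x, p x ≤ 1
  symm : ∀ x, p x⁻¹ = p x
  summable : Summable p

/-- The probability `p(x y⁻¹)` of the pair `[x, y]`. -/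
def EdgeParameter.prob {G : Type*} [Group G] (P : EdgeParameter G) : Sym2 G → unitInterval :=
  Sym2.lift ⟨fun x y => ⟨P.p (x * y⁻¹), P.nonneg _, P.le_one _⟩, fun x y => by
    apply Subtype.ext
    change P.p (x * y⁻¹) = P.p (y * x⁻¹)
    rw [← P.symm (x * y⁻¹)]
    congr 1
    group⟩

/-- The sample space: all configurations of open (`true`) and closed (`false`) edges, with the
`σ`-algebra generated by the cylinder sets. -/
abbrev Config (G : Type*) := Edge G → Bool

/-- The product measure on configurations under which the edge `e` is open with probability
`P.prob e`. -/
def EdgeParameter.measure {G : Type*} [Group G] (P : EdgeParameter G) : Measure (Config G) :=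
  Measure.infinitePi (fun e : Edge G => bernoulliMeasure true false (P.prob e.1))

/-- The percolation graph `Γ_ω` on the vertex set `G`. -/
def percolationGraph {G : Type*} (ω : Config G) : SimpleGraph G where
  Adj x y := ∃ h : ¬ (s(x, y) : Sym2 G).IsDiag, ω ⟨s(x, y), h⟩ = true
  symm := ⟨by
    rintro x y ⟨h, hω⟩
    have e : (s(y, x) : Sym2 G) = s(x, y) := Sym2.eq_swap
    exact ⟨by rw [e]; exact h, by simpa only [e] using hω⟩⟩
  loopless := ⟨fun x ⟨h, _⟩ => h (by simp)⟩

/-! ### Laplacians -/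

/-- The Laplacian of a locally finite graph `Γ` on the space of finitely supported functions:
`(Δ f)(x) = m(x) f(x) - ∑_{y ∼ x} f(y)`, where `m(x)` is the degree of `x`. -/
def laplacian {G : Type*} (Γ : SimpleGraph G) : (G →₀ ℂ) →ₗ[ℂ] (G → ℂ) :=
  open Classical in
  LinearMap.pi fun x =>
    ((Γ.neighborSet x).ncard : ℂ) • Finsupp.lapply x -
      Finsupp.lsum ℂ (fun y : G => if Γ.Adj x y then (LinearMap.id : ℂ →ₗ[ℂ] ℂ) else 0)

theorem laplacian_apply {G : Type*} (Γ : SimpleGraph G) (f : G →₀ ℂ) (x : G) :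
    laplacian Γ f x = ((Γ.neighborSet x).ncard : ℂ) * f x -
      open Classical in ∑ y ∈ f.support with Γ.Adj x y, f y := by
  classical
  simp only [laplacian, LinearMap.pi_apply, LinearMap.sub_apply, LinearMap.smul_apply,
    Finsupp.lapply_apply, smul_eq_mul, Finsupp.lsum_apply, Finsupp.sum, Finset.sum_filter]
  congr 1
  refine Finset.sum_congr rfl fun y _ => ?_
  split_ifs <;> simp

/-- The inclusion `i_Q : ℓ²(Q) → C_c(G)`, extension by zero. -/
def inclusion {G : Type*} (Q : Finset G) : EuclideanSpace ℂ Q →ₗ[ℂ] (G →₀ ℂ) :=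
  open Classical in
  { toFun := fun u => Finsupp.onFinset Q (fun g => if h : g ∈ Q then u ⟨g, h⟩ else 0)
      (fun g hg => by by_contra h; simp [h] at hg)
    map_add' := fun u v => by ext g; by_cases h : g ∈ Q <;> simp [h]
    map_smul' := fun c u => by ext g; by_cases h : g ∈ Q <;> simp [h] }

/-- The projection `p_Q`, restriction of functions on `G` to `Q`. -/
def projection {G : Type*} (Q : Finset G) : (G → ℂ) →ₗ[ℂ] EuclideanSpace ℂ Q where
  toFun f := WithLp.toLp 2 fun x => f x
  map_add' _ _ := rfl
  map_smul' _ _ := rfl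

/-- The restriction `Δ_Γ[Q] = p_Q Δ_Γ i_Q` of the Laplacian of the graph `Γ` to the finite set
`Q`; the diagonal entries are the degrees in the whole graph `Γ`. -/
def restrictedLaplacian {G : Type*} (Γ : SimpleGraph G) (Q : Finset G) :
    EuclideanSpace ℂ Q →ₗ[ℂ] EuclideanSpace ℂ Q :=
  projection Q ∘ₗ laplacian Γ ∘ₗ inclusion Q

theorem restrictedLaplacian_apply {G : Type*} (Γ : SimpleGraph G) (Q : Finset G)
    (u : EuclideanSpace ℂ Q) (x : Q) :
    restrictedLaplacian Γ Q u x = ((Γ.neighborSet (x : G)).ncard : ℂ) * u x -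
      open Classical in ∑ y : Q, if Γ.Adj (x : G) (y : G) then u y else 0 := by
  classical
  change laplacian Γ (inclusion Q u) x = _
  rw [laplacian_apply]
  have h1 : ∀ y : Q, inclusion Q u y = u y := fun y => by simp [inclusion]
  have h2 : (inclusion Q u).support ⊆ Q := fun y hy => by
    by_contra h
    exact Finsupp.mem_support_iff.mp hy (by simp [inclusion, h])
  congr 1
  · rw [h1]
  · rw [Finset.sum_filter, Finset.sum_subset h2, ← Finset.sum_coe_sort]
    · simp only [h1]
    · intro y _ hy
      simp [Finsupp.notMem_support_iff.mp hy]

/-- The Laplacian of a finite graph `S`: `(Δ_S f)(x) = ∑_{y ∼ x} (f(x) - f(y))`. -/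
def finiteLaplacian {V : Type*} [Fintype V] (S : SimpleGraph V) :
    EuclideanSpace ℂ V →ₗ[ℂ] EuclideanSpace ℂ V :=
  open Classical in
  { toFun := fun f => WithLp.toLp 2 fun x => ∑ y : V with S.Adj x y, (f x - f y)
    map_add' := fun f g => by
      ext x
      simp only [PiLp.add_apply, ← Finset.sum_add_distrib]
      exact Finset.sum_congr rfl fun y _ => by ring
    map_smul' := fun c f => by
      ext x
      simp only [PiLp.smul_apply, smul_eq_mul, RingHom.id_apply, Finset.mul_sum]
      exact Finset.sum_congr rfl fun y _ => by ring }

/-- An operator of the form "real diagonal minus symmetric adjacency" is symmetric. -/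
theorem isSymmetric_of_apply {V : Type*} [Fintype V] (S : SimpleGraph V) (m : V → ℕ)
    (A : EuclideanSpace ℂ V →ₗ[ℂ] EuclideanSpace ℂ V)
    (hA : ∀ u x, A u x = (m x : ℂ) * u x - open Classical in ∑ y : V, if S.Adj x y then u y else 0) :
    A.IsSymmetric := by
  classical
  intro u v
  simp only [PiLp.inner_apply, RCLike.inner_apply, hA, map_sub, map_mul, map_natCast, mul_sub,
    sub_mul, Finset.sum_sub_distrib]
  congr 1
  · exact Finset.sum_congr rfl fun x _ => by ring
  · simp only [map_sum, Finset.mul_sum, Finset.sum_mul]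
    rw [Finset.sum_comm]
    refine Finset.sum_congr rfl fun x _ => Finset.sum_congr rfl fun y _ => ?_
    simp only [S.adj_comm y x]
    split_ifs <;> simp

theorem restrictedLaplacian_isSymmetric {G : Type*} (Γ : SimpleGraph G) (Q : Finset G) :
    (restrictedLaplacian Γ Q).IsSymmetric :=
  isSymmetric_of_apply (Γ.induce (Q : Set G)) (fun x => (Γ.neighborSet (x : G)).ncard)
    (restrictedLaplacian Γ Q) (restrictedLaplacian_apply Γ Q)

theorem finiteLaplacian_isSymmetric {V : Type*} [Fintype V] (S : SimpleGraph V) :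
    (finiteLaplacian S).IsSymmetric := by
  classical
  refine isSymmetric_of_apply S (fun x => (Finset.univ.filter (S.Adj x)).card) _ fun u x => ?_
  change ∑ y : V with S.Adj x y, (u x - u y) = _
  rw [Finset.sum_sub_distrib, Finset.sum_const, nsmul_eq_mul, ← Finset.sum_filter]

/-- The eigenvalue counting function `n(A)(E)` of a self-adjoint operator `A` on a
finite-dimensional Hilbert space: the number of eigenvalues of `A`, counted with multiplicity,
not exceeding `E`. -/
def eigenvalueCount {V : Type*} [NormedAddCommGroup V] [InnerProductSpace ℂ V]
    [FiniteDimensional ℂ V] (A : V →ₗ[ℂ] V) (hA : A.IsSymmetric) (E : ℝ) : ℕ :=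
  Nat.card {i : Fin (Module.finrank ℂ V) // hA.eigenvalues rfl i ≤ E}

/-- `F_Γ(Q) = n(Δ_Γ[Q])`. -/
def restrictedCount {G : Type*} (Γ : SimpleGraph G) (Q : Finset G) (E : ℝ) : ℕ :=
  eigenvalueCount (restrictedLaplacian Γ Q) (restrictedLaplacian_isSymmetric Γ Q) E

/-- `F̃(S) = n(Δ_S)` for a finite graph `S`. -/
def finiteCount {V : Type*} [Fintype V] (S : SimpleGraph V) (E : ℝ) : ℕ :=
  eigenvalueCount (finiteLaplacian S) (finiteLaplacian_isSymmetric S) E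

/-! ### Frequencies of patterns

A finite subgraph of the complete graph on `G` with vertex set `V` is a `SimpleGraph` on the
subtype of `V : Finset G`. -/

/-- The number of `x : G` with `V x ⊆ U` such that the subgraph of `Γ` induced on `V x` is the
translate `S x` of the graph `S` with vertex set `V`. -/
def occurrences {G : Type*} [Group G] {V : Finset G} (S : SimpleGraph V) (Γ : SimpleGraph G)
    (U : Finset G) : ℕ :=
  {x : G | (∀ a : V, (a : G) * x ∈ U) ∧
    ∀ a b : V, Γ.Adj ((a : G) * x) ((b : G) * x) ↔ S.Adj a b}.ncard

/-- `ν_S = ∏_{[x,y] ∈ E_S} p(x y⁻¹) ∏_{[x,y] ∉ E_S, x ≠ y ∈ V} (1 - p(x y⁻¹))`. -/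
def EdgeParameter.frequency {G : Type*} [Group G] (P : EdgeParameter G) {V : Finset G}
    (S : SimpleGraph V) : ℝ :=
  open Classical in
  (∏ e ∈ S.edgeFinset, (P.prob (e.map Subtype.val) : ℝ)) *
    ∏ e ∈ Sᶜ.edgeFinset, (1 - (P.prob (e.map Subtype.val) : ℝ))

/-- `∑_{S ∈ 𝒮(Q)} ν_S n(Δ_S)(E) / |Q|`, the sum being over all graphs `S` with vertex set `Q`. -/
def EdgeParameter.patternSum {G : Type*} [Group G] (P : EdgeParameter G) (Q : Finset G)
    (E : ℝ) : ℝ :=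
  open Classical in
  ∑ S : SimpleGraph Q, P.frequency S * ((finiteCount S E : ℝ) / (Q.card : ℝ))

end LongRangePercolation

end

/-! The nonrandom numbers `P.patternSum (Q n)` approximate the random counting functions of `Q j`,
uniformly in the energy, once `j` is large depending on `n`. This alone gives a common limit: two
approximants are compared through the same large `j`, so they form a uniform Cauchy sequence, and
the limit is nonrandom because the approximants are.

To compare, fix a monotile `V = Q n` and let `T` index the tiles of its tiling that lie inside `U =
Q j`. Functions on the tiles embed isometrically into functions on `U`. If such a function, extended
by zero, has equal values at both ends of every open edge that meets `U` but is not contained in a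
tile, then the quadratic form of the restricted Laplacian is the sum of the quadratic forms of the
tile Laplacians. These are finitely many linear conditions, so by min-max the two counting functions
differ by at most the number of such edges plus the number of points of `U` outside the tiles
(`sum_finiteCount_le`, `restrictedCount_add_le`). The degrees may be unbounded; only the rank of the
conditions enters, hence uniformity in the energy.

Both errors are `o(|U|)` as `j → ∞` and then `n → ∞`. The uncovered part is negligible by the Følner
property. The expected number of open crossing edges is at most `|T|` times `boundaryWeight V` plus
`‖p‖₁` times the number of uncovered points, and `boundaryWeight (Q n) / |Q n| → 0` by dominated
convergence; a Chernoff bound makes this almost sure.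

The patterns on disjoint tiles are independent with law `ν_S`, because `p(x y⁻¹)` is invariant under
right translation. Hoeffding's inequality and Borel–Cantelli, with summability from `j < |Q j|`,
turn the average over tiles into `patternSum V`. For frequencies along all translates, which
overlap, `G` is split into finitely many classes with disjoint translates inside each class. -/

noncomputable section

namespace LongRangePercolation

/-! ### Eigenvalue counting functions -/

section Spectral

variable {V : Type*} [NormedAddCommGroup V] [InnerProductSpace ℂ V] [FiniteDimensional ℂ V]

open Module

/-- The span of the eigenvectors of `A` whose index satisfies `p`. -/
def spectralSubspace (A : V →ₗ[ℂ] V) (hA : A.IsSymmetric) (p : Fin (finrank ℂ V) → Prop) :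
    Submodule ℂ V :=
  Submodule.span ℂ (Set.range fun i : {i // p i} => hA.eigenvectorBasis rfl i)

theorem finrank_spectralSubspace (A : V →ₗ[ℂ] V) (hA : A.IsSymmetric)
    (p : Fin (finrank ℂ V) → Prop) :
    finrank ℂ (spectralSubspace A hA p) = Nat.card {i // p i} := by
  classical
  rw [spectralSubspace, finrank_span_eq_card, Nat.card_eq_fintype_card]
  exact (hA.eigenvectorBasis rfl).orthonormal.linearIndependent.comp _ Subtype.val_injective

theorem repr_eq_zero_of_mem_spectralSubspace (A : V →ₗ[ℂ] V) (hA : A.IsSymmetric)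
    {p : Fin (finrank ℂ V) → Prop} {v : V} (hv : v ∈ spectralSubspace A hA p)
    {i : Fin (finrank ℂ V)} (hi : ¬ p i) : (hA.eigenvectorBasis rfl).repr v i = 0 := by
  refine Submodule.span_induction (p := fun v _ => (hA.eigenvectorBasis rfl).repr v i = 0)
    ?_ (by simp) (fun x y _ _ hx hy => by simp [hx, hy]) (fun c x _ hx => by simp [hx]) hv
  rintro _ ⟨j, rfl⟩
  have : i ≠ j := fun h => hi (h ▸ j.2)
  simp [OrthonormalBasis.repr_self, this]

theorem re_inner_sub_eq_sum (A : V →ₗ[ℂ] V) (hA : A.IsSymmetric) (E : ℝ) (v : V) :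
    (inner ℂ (A v) v).re - E * ‖v‖ ^ 2 =
      ∑ i, (hA.eigenvalues rfl i - E) * ‖(hA.eigenvectorBasis rfl).repr v i‖ ^ 2 := by
  have h1 : ‖v‖ ^ 2 = ∑ i, ‖(hA.eigenvectorBasis rfl).repr v i‖ ^ 2 := by
    rw [← EuclideanSpace.norm_sq_eq, LinearIsometryEquiv.norm_map]
  have h2 : (inner ℂ (A v) v).re =
      ∑ i, hA.eigenvalues rfl i * ‖(hA.eigenvectorBasis rfl).repr v i‖ ^ 2 := by
    rw [← (hA.eigenvectorBasis rfl).repr.inner_map_map, PiLp.inner_apply, Complex.re_sum]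
    refine Finset.sum_congr rfl fun i _ => ?_
    rw [hA.eigenvectorBasis_apply_self_apply rfl v i, RCLike.inner_apply, map_mul,
      RCLike.conj_ofReal, mul_left_comm, Complex.mul_conj, Complex.normSq_eq_norm_sq]
    simp only [Complex.re_ofReal_mul, Complex.ofReal_re, Complex.coe_algebraMap]
  rw [h1, h2, Finset.mul_sum, ← Finset.sum_sub_distrib]
  exact Finset.sum_congr rfl fun i _ => by ring

theorem re_inner_le_of_mem_spectralSubspace (A : V →ₗ[ℂ] V) (hA : A.IsSymmetric) {E : ℝ} {v : V}
    (hv : v ∈ spectralSubspace A hA fun i => hA.eigenvalues rfl i ≤ E) :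
    (inner ℂ (A v) v).re ≤ E * ‖v‖ ^ 2 := by
  rw [← sub_nonpos, re_inner_sub_eq_sum A hA]
  refine Finset.sum_nonpos fun i _ => ?_
  by_cases hi : hA.eigenvalues rfl i ≤ E
  · exact mul_nonpos_of_nonpos_of_nonneg (sub_nonpos.2 hi) (by positivity)
  · simp [repr_eq_zero_of_mem_spectralSubspace A hA hv hi]

theorem lt_re_inner_of_mem_spectralSubspace (A : V →ₗ[ℂ] V) (hA : A.IsSymmetric) {E : ℝ} {v : V}
    (hv : v ∈ spectralSubspace A hA fun i => ¬ hA.eigenvalues rfl i ≤ E) (h0 : v ≠ 0) :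
    E * ‖v‖ ^ 2 < (inner ℂ (A v) v).re := by
  rw [← sub_pos, re_inner_sub_eq_sum A hA]
  have hnn : ∀ i, 0 ≤ (hA.eigenvalues rfl i - E) * ‖(hA.eigenvectorBasis rfl).repr v i‖ ^ 2 := by
    intro i
    by_cases hi : hA.eigenvalues rfl i ≤ E
    · simp [repr_eq_zero_of_mem_spectralSubspace A hA hv (not_not.2 hi)]
    · exact mul_nonneg (sub_nonneg.2 (not_le.1 hi).le) (by positivity)
  obtain ⟨i, hi⟩ : ∃ i, (hA.eigenvectorBasis rfl).repr v i ≠ 0 := by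
    by_contra! h
    exact h0 ((hA.eigenvectorBasis rfl).repr.map_eq_zero_iff.1 (by ext i; exact h i))
  have hE : ¬ hA.eigenvalues rfl i ≤ E := fun h =>
    hi (repr_eq_zero_of_mem_spectralSubspace A hA hv (not_not.2 h))
  refine Finset.sum_pos' (fun i _ => hnn i) ⟨i, Finset.mem_univ _, ?_⟩
  exact mul_pos (sub_pos.2 (not_le.1 hE)) (by positivity)

theorem eigenvalueCount_add (A : V →ₗ[ℂ] V) (hA : A.IsSymmetric) (E : ℝ) :
    eigenvalueCount A hA E + Nat.card {i // ¬ hA.eigenvalues rfl i ≤ E} = finrank ℂ V := by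
  classical
  rw [eigenvalueCount, Nat.card_eq_fintype_card, Nat.card_eq_fintype_card,
    Fintype.card_subtype_compl, Fintype.card_fin, Nat.add_sub_cancel']
  simpa using Fintype.card_subtype_le fun i => hA.eigenvalues rfl i ≤ E

theorem eigenvalueCount_le (A : V →ₗ[ℂ] V) (hA : A.IsSymmetric) (E : ℝ) :
    eigenvalueCount A hA E ≤ finrank ℂ V := by
  have := eigenvalueCount_add A hA E
  omega

/-- One half of min-max: `W` meets the span of the eigenvectors with eigenvalue above `E` only in
zero, since the form is too large there. -/
theorem finrank_le_eigenvalueCount (A : V →ₗ[ℂ] V) (hA : A.IsSymmetric) {E : ℝ}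
    (W : Submodule ℂ V) (hW : ∀ v ∈ W, (inner ℂ (A v) v).re ≤ E * ‖v‖ ^ 2) :
    finrank ℂ W ≤ eigenvalueCount A hA E := by
  have hd : Disjoint W (spectralSubspace A hA fun i => ¬ hA.eigenvalues rfl i ≤ E) := by
    rw [Submodule.disjoint_def]
    intro v hv hv'
    by_contra h0
    exact (hW v hv).not_gt (lt_re_inner_of_mem_spectralSubspace A hA hv' h0)
  have h1 := Submodule.finrank_add_finrank_le_of_disjoint hd
  have h2 := eigenvalueCount_add A hA E
  rw [finrank_spectralSubspace] at h1
  omega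

/-- The other half of min-max. The strict inequality is what separates `W` from eigenvectors with
eigenvalue exactly `E`. -/
theorem finrank_add_eigenvalueCount_le (A : V →ₗ[ℂ] V) (hA : A.IsSymmetric) {E : ℝ}
    (W : Submodule ℂ V) (hW : ∀ v ∈ W, v ≠ 0 → E * ‖v‖ ^ 2 < (inner ℂ (A v) v).re) :
    finrank ℂ W + eigenvalueCount A hA E ≤ finrank ℂ V := by
  have hd : Disjoint W (spectralSubspace A hA fun i => hA.eigenvalues rfl i ≤ E) := by
    rw [Submodule.disjoint_def]
    intro v hv hv'
    by_contra h0
    exact (hW v hv h0).not_ge (re_inner_le_of_mem_spectralSubspace A hA hv')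
  have h1 := Submodule.finrank_add_finrank_le_of_disjoint hd
  rw [finrank_spectralSubspace] at h1
  exact h1

theorem finrank_le_finrank_inf_ker_add {C : Type*} [Fintype C] (L : V →ₗ[ℂ] (C → ℂ))
    (W : Submodule ℂ V) :
    finrank ℂ W ≤ finrank ℂ (W ⊓ LinearMap.ker L : Submodule ℂ V) + Fintype.card C := by
  have h1 := Submodule.finrank_sup_add_finrank_inf_eq W (LinearMap.ker L)
  have h2 := L.finrank_range_add_finrank_ker
  have h3 := Submodule.finrank_le (W ⊔ LinearMap.ker L)
  have h4 := Submodule.finrank_le (LinearMap.range L)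
  rw [finrank_fintype_fun_eq_card] at h4
  omega

/-! ### Comparison of an operator with a direct sum of blocks -/

section Blocks

variable {H : Type*} [NormedAddCommGroup H] [InnerProductSpace ℂ H] [FiniteDimensional ℂ H]
  {ι C : Type*} [Fintype ι] [Fintype C]

theorem finrank_submodule_pi (W : ι → Submodule ℂ H) :
    finrank ℂ (Submodule.pi Set.univ W) = ∑ i, finrank ℂ (W i) := by
  rw [← finrank_pi_fintype]
  exact LinearEquiv.finrank_eq
    { toFun := fun w i => ⟨w.1 i, w.2 i trivial⟩
      invFun := fun w => ⟨fun i => w i, fun i _ => (w i).2⟩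
      map_add' := fun _ _ => rfl
      map_smul' := fun _ _ => rfl
      left_inv := fun _ => rfl
      right_inv := fun _ => rfl }

theorem sum_finrank_le_finrank_map_pi_inf_ker (Φ : (ι → H) →ₗ[ℂ] V)
    (hΦ : ∀ w, ‖Φ w‖ ^ 2 = ∑ i, ‖w i‖ ^ 2) (L : V →ₗ[ℂ] (C → ℂ)) (W : ι → Submodule ℂ H) :
    ∑ i, finrank ℂ (W i) ≤
      finrank ℂ ((Submodule.pi Set.univ W).map Φ ⊓ LinearMap.ker L : Submodule ℂ V) +
        Fintype.card C := by
  have hinj : Function.Injective Φ := by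
    rw [injective_iff_map_eq_zero]
    intro w hw
    have h := hΦ w
    rw [hw, norm_zero, zero_pow two_ne_zero, eq_comm,
      Finset.sum_eq_zero_iff_of_nonneg fun i _ => by positivity] at h
    funext i
    simpa using h i (Finset.mem_univ i)
  have h := finrank_le_finrank_inf_ker_add L ((Submodule.pi Set.univ W).map Φ)
  rwa [(Submodule.equivMapOfInjective Φ hinj _).symm.finrank_eq, finrank_submodule_pi] at h

/-- The low-energy subspaces of the blocks are glued together and cut by the `|C|` conditions `L =
0`, which costs at most `|C|` dimensions; what remains is a trial space for `A`. -/
theorem sum_eigenvalueCount_le (A : V →ₗ[ℂ] V) (hA : A.IsSymmetric) (B : ι → H →ₗ[ℂ] H)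
    (hB : ∀ i, (B i).IsSymmetric) (Φ : (ι → H) →ₗ[ℂ] V)
    (hΦ : ∀ w, ‖Φ w‖ ^ 2 = ∑ i, ‖w i‖ ^ 2) (L : V →ₗ[ℂ] (C → ℂ))
    (hL : ∀ w, L (Φ w) = 0 →
      (inner ℂ (A (Φ w)) (Φ w)).re = ∑ i, (inner ℂ (B i (w i)) (w i)).re) (E : ℝ) :
    ∑ i, eigenvalueCount (B i) (hB i) E ≤ eigenvalueCount A hA E + Fintype.card C := by
  have h := sum_finrank_le_finrank_map_pi_inf_ker Φ hΦ L
    fun i => spectralSubspace (B i) (hB i) fun k => (hB i).eigenvalues rfl k ≤ E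
  simp only [finrank_spectralSubspace] at h
  refine h.trans (Nat.add_le_add_right (finrank_le_eigenvalueCount A hA _ ?_) _)
  rintro _ ⟨⟨w, hw, rfl⟩, hk⟩
  rw [hL w hk, hΦ, Finset.mul_sum]
  exact Finset.sum_le_sum fun i _ => re_inner_le_of_mem_spectralSubspace _ _ (hw i trivial)

/-- The same with the high-energy subspaces. The defect `dim V - |ι| dim H`, the dimension missed by
the blocks, is moved across the inequality to stay in the natural numbers. -/
theorem eigenvalueCount_le_sum (A : V →ₗ[ℂ] V) (hA : A.IsSymmetric) (B : ι → H →ₗ[ℂ] H)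
    (hB : ∀ i, (B i).IsSymmetric) (Φ : (ι → H) →ₗ[ℂ] V)
    (hΦ : ∀ w, ‖Φ w‖ ^ 2 = ∑ i, ‖w i‖ ^ 2) (L : V →ₗ[ℂ] (C → ℂ))
    (hL : ∀ w, L (Φ w) = 0 →
      (inner ℂ (A (Φ w)) (Φ w)).re = ∑ i, (inner ℂ (B i (w i)) (w i)).re) (E : ℝ) :
    eigenvalueCount A hA E + Fintype.card ι * finrank ℂ H ≤
      ∑ i, eigenvalueCount (B i) (hB i) E + finrank ℂ V + Fintype.card C := by
  have h := sum_finrank_le_finrank_map_pi_inf_ker Φ hΦ L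
    fun i => spectralSubspace (B i) (hB i) fun k => ¬ (hB i).eigenvalues rfl k ≤ E
  simp only [finrank_spectralSubspace] at h
  have h2 : ∑ i, eigenvalueCount (B i) (hB i) E +
      ∑ i, Nat.card {k // ¬ (hB i).eigenvalues rfl k ≤ E} = Fintype.card ι * finrank ℂ H := by
    rw [← Finset.sum_add_distrib, Finset.sum_congr rfl fun i _ => eigenvalueCount_add _ (hB i) E]
    simp
  have h3 := finrank_add_eigenvalueCount_le A hA (E := E) _ (fun v (hv : v ∈
      (Submodule.pi Set.univ fun i => spectralSubspace (B i) (hB i)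
        fun k => ¬ (hB i).eigenvalues rfl k ≤ E).map Φ ⊓ LinearMap.ker L) hv0 => by
    obtain ⟨⟨w, hw, rfl⟩, hk⟩ := hv
    rw [hL w hk, hΦ, Finset.mul_sum]
    obtain ⟨i, hi⟩ : ∃ i, w i ≠ 0 := by
      by_contra! h
      exact hv0 (by rw [show w = 0 from funext h, map_zero])
    refine Finset.sum_lt_sum (fun j _ => ?_) ⟨i, Finset.mem_univ i,
      lt_re_inner_of_mem_spectralSubspace _ _ (hw i trivial) hi⟩
    by_cases hj : w j = 0
    · simp [hj]
    · exact (lt_re_inner_of_mem_spectralSubspace _ _ (hw j trivial) hj).le)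
  omega

end Blocks

/-! ### The counting function is a distribution function up to normalization -/

theorem eigenvalueCount_mono (A : V →ₗ[ℂ] V) (hA : A.IsSymmetric) :
    Monotone (eigenvalueCount A hA) := fun _ _ h =>
  Nat.card_le_card_of_injective (Subtype.map id fun _ hi => hi.trans h)
    (Subtype.map_injective _ Function.injective_id)

theorem eventually_eigenvalueCount_eq (A : V →ₗ[ℂ] V) (hA : A.IsSymmetric) (E : ℝ) :
    ∀ᶠ x in 𝓝[≥] E, eigenvalueCount A hA x = eigenvalueCount A hA E := by
  have h : ∀ i, ∀ᶠ x in 𝓝[≥] E, (hA.eigenvalues rfl i ≤ x ↔ hA.eigenvalues rfl i ≤ E) := by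
    intro i
    by_cases hi : hA.eigenvalues rfl i ≤ E
    · filter_upwards [self_mem_nhdsWithin] with x hx
      simp [hi, hi.trans hx]
    · filter_upwards [mem_nhdsWithin_of_mem_nhds (Iio_mem_nhds (not_le.1 hi))] with x hx
      simpa [hi] using hx
  filter_upwards [eventually_all.2 h] with x hx
  simp only [eigenvalueCount, hx]

theorem eventually_atBot_eigenvalueCount_eq (A : V →ₗ[ℂ] V) (hA : A.IsSymmetric) :
    ∀ᶠ x in atBot, eigenvalueCount A hA x = 0 := by
  filter_upwards [eventually_all.2 fun i => eventually_lt_atBot (hA.eigenvalues rfl i)] with x hx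
  simp only [eigenvalueCount, Nat.card_eq_zero, isEmpty_subtype, not_le]
  exact Or.inl hx

theorem eventually_atTop_eigenvalueCount_eq (A : V →ₗ[ℂ] V) (hA : A.IsSymmetric) :
    ∀ᶠ x in atTop, eigenvalueCount A hA x = finrank ℂ V := by
  filter_upwards [eventually_all.2 fun i => eventually_ge_atTop (hA.eigenvalues rfl i)] with x hx
  exact (Nat.card_congr (Equiv.subtypeUnivEquiv hx)).trans (Nat.card_fin _)

end Spectral

/-! ### Probability estimates for the percolation measure -/

section Probability

variable {G : Type*} [Group G] (P : EdgeParameter G)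

instance : IsProbabilityMeasure P.measure := by
  unfold EdgeParameter.measure
  infer_instance

theorem EdgeParameter.iIndepFun_eval :
    iIndepFun (fun (e : Edge G) (ω : Config G) => ω e) P.measure :=
  iIndepFun_infinitePi (X := fun _ ω => ω) (fun _ => measurable_id)

theorem EdgeParameter.measurePreserving_eval (e : Edge G) :
    MeasurePreserving (Function.eval e) P.measure (bernoulliMeasure true false (P.prob e.1)) :=
  measurePreserving_eval_infinitePi _ e

theorem EdgeParameter.measureReal_eval_eq (e : Edge G) (b : Bool) :
    P.measure.real {ω | ω e = b} = if b then (P.prob e.1 : ℝ) else 1 - P.prob e.1 := by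
  have h : {ω : Config G | ω e = b} = Function.eval e ⁻¹' ({b} : Set Bool) := rfl
  rw [h, measureReal_def, (P.measurePreserving_eval e).measure_preimage
    (measurableSet_singleton b).nullMeasurableSet, ← measureReal_def,
    bernoulliMeasure_real_apply _ (measurableSet_singleton b)]
  cases b <;> simp

theorem EdgeParameter.measure_eval_true (e : Edge G) :
    P.measure {ω | ω e = true} = ENNReal.ofReal (P.prob e.1) := by
  rw [← ENNReal.ofReal_toReal (measure_ne_top P.measure _), ← measureReal_def,
    P.measureReal_eval_eq, if_pos rfl]

/-! #### Number of open edges -/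

theorem EdgeParameter.mgf_eval_le (e : Edge G) :
    mgf (fun ω : Config G => if ω e then (1 : ℝ) else 0) P.measure 1 ≤
      Real.exp (2 * P.prob e.1) := by
  have h : mgf (fun ω : Config G => if ω e then (1 : ℝ) else 0) P.measure 1 =
      ∫ b, Real.exp (if b then 1 else 0) ∂(bernoulliMeasure true false (P.prob e.1)) := by
    rw [← (P.measurePreserving_eval e).map_eq, integral_map
      (measurable_pi_apply e).aemeasurable (measurable_of_finite _).aestronglyMeasurable]
    simp [mgf]
  rw [h, integral_bernoulliMeasure]
  simp only [if_true, Bool.false_eq_true, if_false, Real.exp_zero, smul_eq_mul, mul_one]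
  -- The generating function is `1 + p (e - 1)`, and `e < 3` bounds it by `1 + 2 p ≤ exp (2 p)`.
  have h1 := Real.exp_one_lt_d9
  have h2 := Real.add_one_le_exp (2 * (P.prob e.1 : ℝ))
  have h3 := (P.prob e.1).2.1
  have h4 : (P.prob e.1 : ℝ) * Real.exp 1 ≤ P.prob e.1 * 3 :=
    mul_le_mul_of_nonneg_left (by linarith) h3
  change (P.prob e.1 : ℝ) * Real.exp 1 + (1 - P.prob e.1) ≤ _
  linarith

theorem EdgeParameter.measureReal_card_open_ge_le (F : Finset (Edge G)) (a : ℝ) :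
    P.measure.real {ω | a ≤ ((F.filter fun e => ω e = true).card : ℝ)} ≤
      Real.exp (2 * ∑ e ∈ F, (P.prob e.1 : ℝ) - a) := by
  have hind : iIndepFun (fun (e : Edge G) (ω : Config G) => if ω e then (1 : ℝ) else 0)
      P.measure :=
    P.iIndepFun_eval.comp (fun _ b => if b then (1 : ℝ) else 0) fun _ => measurable_of_finite _
  have hmeas : ∀ e : Edge G, Measurable fun ω : Config G => if ω e then (1 : ℝ) else 0 := fun e =>
    (measurable_of_finite fun b : Bool => if b then (1 : ℝ) else 0).comp (measurable_pi_apply e)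
  have hcard : ∀ ω : Config G, ((F.filter fun e => ω e = true).card : ℝ) =
      (∑ e ∈ F, fun ω : Config G => if ω e then (1 : ℝ) else 0) ω := by
    intro ω
    rw [Finset.sum_apply, Finset.sum_boole]
  simp only [hcard]
  have hint : Integrable (fun ω => Real.exp (1 *
      (∑ e ∈ F, fun ω : Config G => if ω e then (1 : ℝ) else 0) ω)) P.measure := by
    refine Integrable.of_bound (C := Real.exp F.card) ?_ (ae_of_all _ fun ω => ?_)
    · have hm : Measurable (∑ e ∈ F, fun ω : Config G => if ω e then (1 : ℝ) else 0) := by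
        simpa only [← Finset.sum_fn] using Finset.measurable_sum F fun e _ => hmeas e
      exact (hm.const_mul 1).exp.aestronglyMeasurable
    · rw [Real.norm_eq_abs, Real.abs_exp, one_mul, ← hcard]
      exact Real.exp_le_exp.2 (by exact_mod_cast Finset.card_filter_le _ _)
  refine (measure_ge_le_exp_mul_mgf a zero_le_one hint).trans ?_
  rw [hind.mgf_sum hmeas, sub_eq_add_neg, add_comm, Real.exp_add, neg_one_mul, Finset.mul_sum,
    Real.exp_sum]
  gcongr with e _
  · exact fun _ _ => mgf_nonneg
  · exact P.mgf_eval_le e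

/-- The set `A` may be infinite. No union bound is paid for the choice of `F`: the events increase
with `F`, so the measure of their directed countable union is the supremum of the individual
measures. -/
theorem EdgeParameter.measure_exists_card_open_ge_le [Countable G] (A : Set (Edge G)) {m : ℝ}
    (hm : ∀ F : Finset (Edge G), (F : Set (Edge G)) ⊆ A → ∑ e ∈ F, (P.prob e.1 : ℝ) ≤ m) (a : ℝ) :
    P.measure {ω | ∃ F : Finset (Edge G), (F : Set (Edge G)) ⊆ A ∧
      a ≤ ((F.filter fun e => ω e = true).card : ℝ)} ≤ ENNReal.ofReal (Real.exp (2 * m - a)) := by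
  classical
  have h : {ω : Config G | ∃ F : Finset (Edge G), (F : Set (Edge G)) ⊆ A ∧
      a ≤ ((F.filter fun e => ω e = true).card : ℝ)} =
      ⋃ F : {F : Finset (Edge G) // (F : Set (Edge G)) ⊆ A},
        {ω | a ≤ ((F.1.filter fun e => ω e = true).card : ℝ)} := by
    ext ω
    simp
  have : Countable (Edge G) := Subtype.countable
  rw [h, Directed.measure_iUnion]
  · refine iSup_le fun F => ?_
    rw [← ENNReal.ofReal_toReal (measure_ne_top P.measure _), ← measureReal_def]
    refine ENNReal.ofReal_le_ofReal ((P.measureReal_card_open_ge_le F.1 a).trans ?_)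
    exact Real.exp_le_exp.2 (by linarith [hm F.1 F.2])
  · intro F F'
    refine ⟨⟨F.1 ∪ F'.1, by simpa using ⟨F.2, F'.2⟩⟩, ?_, ?_⟩
    · intro ω (hω : a ≤ _)
      refine hω.trans ?_
      simp only [Nat.cast_le]
      exact Finset.card_le_card (Finset.filter_subset_filter _ Finset.subset_union_left)
    · intro ω (hω : a ≤ _)
      refine hω.trans ?_
      simp only [Nat.cast_le]
      exact Finset.card_le_card (Finset.filter_subset_filter _ Finset.subset_union_right)

/-! #### Borel–Cantelli with exponential bounds -/

theorem ae_eventually_notMem_of_le_exp {Ω : Type*} [MeasurableSpace Ω] {μ : Measure Ω}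
    {B : ℕ → Set Ω} {C c : ℝ} (hC : 0 ≤ C) (hc : 0 < c)
    (h : ∀ᶠ j in atTop, μ (B j) ≤ ENNReal.ofReal (C * Real.exp (j * (-c)))) :
    ∀ᵐ ω ∂μ, ∀ᶠ j in atTop, ω ∉ B j := by
  obtain ⟨n, hn⟩ := eventually_atTop.1 h
  have hs : Summable fun j : ℕ => C * Real.exp (((j + n : ℕ) : ℝ) * (-c)) :=
    (summable_nat_add_iff n).2 ((Real.summable_exp_nat_mul_iff.2 (neg_lt_zero.2 hc)).mul_left C)
  have h2 : ∑' j, μ (B (j + n)) ≠ ⊤ := by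
    refine ne_top_of_le_ne_top ?_ (ENNReal.tsum_le_tsum fun j => hn (j + n) (Nat.le_add_left _ _))
    rw [← ENNReal.ofReal_tsum_of_nonneg (fun j => by positivity) hs]
    exact ENNReal.ofReal_ne_top
  filter_upwards [ae_eventually_notMem h2] with ω hω
  exact (eventually_map (m := fun j => j + n) (P := fun j => ω ∉ B j)).2 hω |>.filter_mono
    (map_add_atTop_eq_nat n).ge

/-! #### Local finiteness -/

/-- Borel–Cantelli at each vertex: the probabilities of the edges at `x` have sum at most `‖p‖₁`. -/
theorem EdgeParameter.ae_finite_neighborSet [Countable G] :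
    ∀ᵐ ω ∂P.measure, ∀ x : G, ((percolationGraph ω).neighborSet x).Finite := by
  rw [ae_all_iff]
  intro x
  have hle : ∀ y : G, P.measure {ω | (percolationGraph ω).Adj x y} ≤
      ENNReal.ofReal (P.p (x * y⁻¹)) := by
    intro y
    by_cases h : (s(x, y) : Sym2 G).IsDiag
    · have : {ω : Config G | (percolationGraph ω).Adj x y} = ∅ :=
        Set.eq_empty_of_forall_notMem fun ω hω => hω.1 h
      simp [this]
    · have : {ω : Config G | (percolationGraph ω).Adj x y} = {ω | ω ⟨s(x, y), h⟩ = true} := by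
        ext ω
        exact ⟨fun hω => hω.2, fun hω => ⟨h, hω⟩⟩
      rw [this, P.measure_eval_true]
      exact le_rfl
  have hsum : Summable fun y : G => P.p (x * y⁻¹) :=
    ((Equiv.inv G).trans (Equiv.mulLeft x)).summable_iff.2 P.summable
  refine ae_finite_setOfPred_mem (s := fun y => {ω | (percolationGraph ω).Adj x y})
    (ne_top_of_le_ne_top ?_ (ENNReal.tsum_le_tsum hle))
  rw [← ENNReal.ofReal_tsum_of_nonneg (fun y => P.nonneg _) hsum]
  exact ENNReal.ofReal_ne_top

/-! #### Patterns -/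

/-- The event that the pattern `S` occurs at the translate `V t`. -/
def patternEvent {V : Finset G} (S : SimpleGraph V) (t : G) : Set (Config G) :=
  {ω | ∀ a b : V, (percolationGraph ω).Adj ((a : G) * t) ((b : G) * t) ↔ S.Adj a b}

/-- The edge `[a t, b t]` for an edge `[a, b]` with endpoints in `V`. -/
def translateEdge {V : Finset G} (t : G) (e : Edge V) : Edge G :=
  ⟨e.1.map fun a : V => (a : G) * t, by
    rw [Sym2.isDiag_map fun (a b : V) h => Subtype.ext (mul_right_cancel h)]
    exact e.2⟩

theorem EdgeParameter.prob_translateEdge {V : Finset G} (t : G) (e : Edge V) :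
    P.prob (translateEdge t e).1 = P.prob (e.1.map Subtype.val) := by
  obtain ⟨e, he⟩ := e
  induction e with | _ a b
  apply Subtype.ext
  change P.p ((a : G) * t * ((b : G) * t)⁻¹) = P.p ((a : G) * (b : G)⁻¹)
  congr 1
  group

/-- An edge inside a tile determines the tile, because the tiles are disjoint. Hence patterns on
different tiles depend on disjoint sets of edges and are independent. -/
theorem translateEdge_injective {V : Finset G} {T : Set G}
    (hT : T.PairwiseDisjoint fun t => (V : Set G) * {t}) :
    Function.Injective fun i : T × Edge V => translateEdge (i.1 : G) i.2 := by
  rintro ⟨⟨t, ht⟩, e, he⟩ ⟨⟨t', ht'⟩, e', he'⟩ h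
  have h1 : e.map (fun a : V => (a : G) * t) = e'.map fun a : V => (a : G) * t' :=
    congrArg Subtype.val h
  have htt : t = t' := by
    by_contra hne
    have hd := hT ht ht' hne
    induction e with | _ a b
    have hm : (a : G) * t ∈ e'.map fun a : V => (a : G) * t' := by
      rw [← h1]
      simp
    obtain ⟨c, -, hc⟩ := Sym2.mem_map.1 hm
    refine Set.disjoint_left.1 hd (Set.mul_mem_mul a.2 rfl) ?_
    rw [← hc]
    exact Set.mul_mem_mul c.2 rfl
  subst htt
  have h2 := Sym2.map.injective (fun (a b : V) h => Subtype.ext (mul_right_cancel h)) h1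
  subst h2
  rfl

open Classical in
theorem patternEvent_eq {V : Finset G} (S : SimpleGraph V) (t : G) :
    patternEvent S t =
      ⋂ e : Edge V, {ω | ω (translateEdge t e) = decide (e.1 ∈ S.edgeSet)} := by
  ext ω
  simp only [patternEvent, Set.mem_iInter, Set.mem_ofPred_eq]
  constructor
  · rintro h ⟨e, he⟩
    induction e with | _ a b
    have := h a b
    rw [Bool.eq_iff_iff, decide_eq_true_iff, SimpleGraph.mem_edgeSet, ← h a b]
    exact ⟨fun hω => ⟨(translateEdge t ⟨s(a, b), he⟩).2, hω⟩, fun hω => hω.2⟩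
  · intro h a b
    by_cases hab : a = b
    · subst hab
      simp
    · have he : ¬ (s(a, b) : Sym2 V).IsDiag := by simpa using hab
      have := h ⟨s(a, b), he⟩
      rw [Bool.eq_iff_iff, decide_eq_true_iff, SimpleGraph.mem_edgeSet] at this
      rw [← this]
      exact ⟨fun hω => hω.2, fun hω => ⟨(translateEdge t ⟨s(a, b), he⟩).2, hω⟩⟩

theorem measurableSet_patternEvent {V : Finset G} (S : SimpleGraph V) (t : G) :
    MeasurableSet (patternEvent S t) := by
  classical
  rw [patternEvent_eq]
  refine MeasurableSet.iInter fun e => ?_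
  have h : Measurable fun ω : Config G => ω (translateEdge t e) := measurable_pi_apply _
  exact h (measurableSet_singleton (decide (e.1 ∈ S.edgeSet)))

theorem EdgeParameter.frequency_eq_prod {V : Finset G} (S : SimpleGraph V) :
    P.frequency S = open Classical in ∏ e : Edge V, if e.1 ∈ S.edgeSet then
      (P.prob (e.1.map Subtype.val) : ℝ) else 1 - P.prob (e.1.map Subtype.val) := by
  classical
  have h1 : ∏ e : Edge V, (if e.1 ∈ S.edgeSet then
      (P.prob (e.1.map Subtype.val) : ℝ) else 1 - P.prob (e.1.map Subtype.val)) =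
      ∏ e ∈ Finset.univ.filter fun e : Sym2 V => ¬ e.IsDiag, if e ∈ S.edgeSet then
      (P.prob (e.map Subtype.val) : ℝ) else 1 - P.prob (e.map Subtype.val) :=
    (Finset.prod_subtype _ (by simp) fun e : Sym2 V => if e ∈ S.edgeSet then
      (P.prob (e.map Subtype.val) : ℝ) else 1 - P.prob (e.map Subtype.val)).symm
  rw [h1, Finset.prod_ite, EdgeParameter.frequency]
  congr 1
  · refine Finset.prod_congr ?_ fun _ _ => rfl
    ext e
    simp only [SimpleGraph.mem_edgeFinset, Finset.mem_filter, Finset.mem_univ, true_and]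
    exact ⟨fun h => ⟨S.not_isDiag_of_mem_edgeSet h, h⟩, fun h => h.2⟩
  · refine Finset.prod_congr ?_ fun _ _ => rfl
    ext e
    simp only [SimpleGraph.mem_edgeFinset, Finset.mem_filter, Finset.mem_univ, true_and]
    induction e with | _ a b
    simp [SimpleGraph.compl_adj]

theorem EdgeParameter.measure_biInter_patternEvent {V : Finset G} (S : SimpleGraph V) {T : Set G}
    (hT : T.PairwiseDisjoint fun t => (V : Set G) * {t}) (s : Finset T) :
    P.measure (⋂ t ∈ s, patternEvent S (t : G)) = ENNReal.ofReal (P.frequency S) ^ s.card := by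
  classical
  have h1 : (⋂ t ∈ s, patternEvent S (t : G)) =
      ⋂ i ∈ s ×ˢ (Finset.univ : Finset (Edge V)),
        (fun ω : Config G => ω (translateEdge (i.1 : G) i.2)) ⁻¹'
          {decide (i.2.1 ∈ S.edgeSet)} := by
    ext ω
    simp only [patternEvent_eq, Set.mem_iInter, Finset.mem_product, Finset.mem_univ, and_true,
      Prod.forall]
    exact ⟨fun h t e ht => h t ht e, fun h t ht e => h t e ht⟩
  rw [h1, (P.iIndepFun_eval.precomp (translateEdge_injective hT)).measure_inter_preimage_eq_mul _
    fun _ _ => measurableSet_singleton _, Finset.prod_product, ← Finset.prod_const]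
  refine Finset.prod_congr rfl fun t _ => ?_
  rw [P.frequency_eq_prod, ENNReal.ofReal_prod_of_nonneg]
  · refine Finset.prod_congr rfl fun e _ => ?_
    change P.measure {ω | ω (translateEdge (t : G) e) = _} = _
    rw [← ENNReal.ofReal_toReal (measure_ne_top P.measure _), ← measureReal_def,
      P.measureReal_eval_eq, P.prob_translateEdge]
    simp
  · intro e _
    split_ifs
    · exact (P.prob _).2.1
    · exact sub_nonneg.2 (P.prob _).2.2

theorem EdgeParameter.frequency_nonneg {V : Finset G} (S : SimpleGraph V) :
    0 ≤ P.frequency S :=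
  mul_nonneg (Finset.prod_nonneg fun _ _ => (P.prob _).2.1)
    (Finset.prod_nonneg fun _ _ => sub_nonneg.2 (P.prob _).2.2)

theorem EdgeParameter.measure_patternEvent {V : Finset G} (S : SimpleGraph V) (t : G) :
    P.measure (patternEvent S t) = ENNReal.ofReal (P.frequency S) := by
  have h := P.measure_biInter_patternEvent S (T := {t}) (Set.pairwiseDisjoint_singleton _ _)
    {⟨t, rfl⟩}
  simpa using h

-- Deviations are measured against `m` rather than `|s|`, so that the bound remains useful when `s`
-- is a small part of a set of size `m`.
open Classical in
theorem EdgeParameter.measureReal_hoeffding {V : Finset G} (S : SimpleGraph V) {T : Set G}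
    (hT : T.PairwiseDisjoint fun t => (V : Set G) * {t}) (s : Finset T) {m δ : ℝ}
    (hs : (s.card : ℝ) ≤ m) (hm : 0 < m) (hδ : 0 < δ) :
    P.measure.real {ω | δ * m ≤
      |((s.filter fun t : T => ω ∈ patternEvent S (t : G)).card : ℝ) - P.frequency S * s.card|} ≤
      2 * Real.exp (-(2 * δ ^ 2) * m) := by
  rcases s.eq_empty_or_nonempty with rfl | hne
  · have : ¬ δ * m ≤ 0 := (mul_pos hδ hm).not_ge
    simp [this]
    positivity
  have hcard : (0 : ℝ) < s.card := by exact_mod_cast hne.card_pos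
  set X : T → Config G → ℝ := fun t => (patternEvent S (t : G)).indicator fun _ => 1 with hX
  have hmeas : ∀ t, Measurable (X t) := fun t =>
    measurable_const.indicator (measurableSet_patternEvent S t)
  have hind : iIndepFun X P.measure := by
    refine iIndepSet.iIndepFun_indicator ?_
    rw [iIndepSet_iff_meas_biInter fun t : T => measurableSet_patternEvent S t]
    intro s
    rw [P.measure_biInter_patternEvent S hT]
    simp [P.measure_patternEvent]
  have hmean : ∀ t, ∫ ω, X t ω ∂P.measure = P.frequency S := by
    intro t
    rw [hX, integral_indicator (measurableSet_patternEvent S _), setIntegral_const,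
      measureReal_def, P.measure_patternEvent, ENNReal.toReal_ofReal (P.frequency_nonneg S)]
    simp
  have hind' : iIndepFun (fun t ω => X t ω - P.frequency S) P.measure :=
    hind.comp (fun _ x => x - P.frequency S) fun _ => measurable_id.sub_const _
  have hind'' : iIndepFun (fun t ω => -(X t ω - P.frequency S)) P.measure :=
    hind.comp (fun _ x => -(x - P.frequency S)) fun _ => (measurable_id.sub_const _).neg
  have hsub : ∀ t, HasSubgaussianMGF (fun ω => X t ω - P.frequency S) ((‖(1 : ℝ) - 0‖₊ / 2) ^ 2)
      P.measure := by
    intro t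
    rw [← hmean t]
    refine hasSubgaussianMGF_of_mem_Icc (hmeas t).aemeasurable (ae_of_all _ fun ω => ?_)
    by_cases hω : ω ∈ patternEvent S (t : G) <;> simp [hX, hω]
  have hsum : ∀ ω, ((s.filter fun t : T => ω ∈ patternEvent S (t : G)).card : ℝ) -
      P.frequency S * s.card = ∑ t ∈ s, (X t ω - P.frequency S) := by
    intro ω
    rw [Finset.sum_sub_distrib, Finset.sum_const, nsmul_eq_mul, mul_comm, ← Finset.sum_boole]
    simp only [hX, Set.indicator_apply]
  -- A variable with values in an interval of length 1 has variance proxy `1/4`. The exponent is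
  -- therefore `-2 δ² m² / |s|`, which is at most `-2 δ² m` because `|s| ≤ m`.
  have hexp : Real.exp (-(δ * m) ^ 2 / (2 * ((∑ t ∈ s, (‖(1 : ℝ) - 0‖₊ / 2) ^ 2 : NNReal) : ℝ))) ≤
      Real.exp (-(2 * δ ^ 2) * m) := by
    rw [Real.exp_le_exp, Finset.sum_const, nsmul_eq_mul, NNReal.coe_mul, NNReal.coe_natCast]
    simp only [sub_zero, nnnorm_one, NNReal.coe_pow, NNReal.coe_div, NNReal.coe_one,
      NNReal.coe_ofNat]
    rw [div_le_iff₀ (by positivity)]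
    have : δ ^ 2 * m * s.card ≤ δ ^ 2 * m * m := by gcongr
    nlinarith
  have h1 := (HasSubgaussianMGF.measure_sum_ge_le_of_iIndepFun hind' (s := s)
    (fun t _ => hsub t) (mul_pos hδ hm).le).trans hexp
  have h2 := (HasSubgaussianMGF.measure_sum_ge_le_of_iIndepFun hind'' (s := s)
    (fun t _ => (hsub t).neg) (mul_pos hδ hm).le).trans hexp
  have hsubset : {ω | δ * m ≤ |((s.filter fun t : T => ω ∈ patternEvent S (t : G)).card : ℝ) -
      P.frequency S * s.card|} ⊆ {ω | δ * m ≤ ∑ t ∈ s, (X t ω - P.frequency S)} ∪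
        {ω | δ * m ≤ ∑ t ∈ s, -(X t ω - P.frequency S)} := by
    intro ω hω
    rw [Set.mem_ofPred_eq, hsum, le_abs] at hω
    simpa only [Set.mem_union, Set.mem_ofPred_eq, Finset.sum_neg_distrib] using hω
  refine (measureReal_mono hsubset (measure_ne_top _ _)).trans
    ((measureReal_union_le _ _).trans ?_)
  linarith

open Classical in
theorem EdgeParameter.ae_tendsto_pattern_sub {V : Finset G} (S : SimpleGraph V) {T : Set G}
    (hT : T.PairwiseDisjoint fun t => (V : Set G) * {t}) (s : ℕ → Finset T) (m : ℕ → ℕ)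
    (hs : ∀ j, (s j).card ≤ m j) (hm : ∀ j, j < m j) :
    ∀ᵐ ω ∂P.measure, Tendsto (fun j =>
      ((((s j).filter fun t : T => ω ∈ patternEvent S (t : G)).card : ℝ) -
        P.frequency S * (s j).card) / m j) atTop (𝓝 0) := by
  have hpos : ∀ j, (0 : ℝ) < m j := fun j => by exact_mod_cast (Nat.zero_le j).trans_lt (hm j)
  -- Countably many thresholds `1 / (k + 1)` suffice. As `j < m j`, the Hoeffding bounds are
  -- dominated by a geometric series.
  have key : ∀ k : ℕ, ∀ᵐ ω ∂P.measure, ∀ᶠ j in atTop, ω ∉ {ω | 1 / ((k : ℝ) + 1) * m j ≤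
      |(((s j).filter fun t : T => ω ∈ patternEvent S (t : G)).card : ℝ) -
        P.frequency S * (s j).card|} := by
    intro k
    have hδ : 0 < 1 / ((k : ℝ) + 1) := by positivity
    refine ae_eventually_notMem_of_le_exp (C := 2) (c := 2 * (1 / ((k : ℝ) + 1)) ^ 2)
      zero_le_two (by positivity) (Eventually.of_forall fun j => ?_)
    rw [← ENNReal.ofReal_toReal (measure_ne_top P.measure _), ← measureReal_def]
    refine ENNReal.ofReal_le_ofReal ((P.measureReal_hoeffding S hT (s j)
      (by exact_mod_cast hs j) (hpos j) hδ).trans ?_)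
    have : (j : ℝ) ≤ m j := by exact_mod_cast (hm j).le
    gcongr 2 * Real.exp ?_
    nlinarith [sq_nonneg (1 / ((k : ℝ) + 1))]
  filter_upwards [ae_all_iff.2 key] with ω hω
  rw [Metric.tendsto_nhds]
  intro ε hε
  obtain ⟨k, hk⟩ := exists_nat_one_div_lt hε
  filter_upwards [hω k] with j hj
  rw [not_le] at hj
  rw [dist_zero_right, Real.norm_eq_abs, abs_div, abs_of_pos (hpos j), div_lt_iff₀ (hpos j)]
  exact hj.trans (mul_lt_mul_of_pos_right hk (hpos j))

end Probability

/-! ### Følner sequences -/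

section Folner

variable {G : Type*} [Group G]

theorem countable_of_fg [Group.FG G] : Countable G := by
  obtain ⟨S, hS, φ, hφ⟩ := Group.fg_iff_exists_freeGroup_hom_surjective.1 ‹Group.FG G›
  have := hS.countable.to_subtype
  have : Countable (FreeGroup S) := Quot.mk_surjective.countable
  exact hφ.countable

open Classical in
/-- The number of `y ∈ U` with `g y ∉ U`. -/
def exitCount (g : G) (U : Finset G) : ℕ := (U.filter fun y => g * y ∉ U).card

theorem exitCount_le (g : G) (U : Finset G) : exitCount g U ≤ U.card := by
  classical
  exact Finset.card_filter_le U _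

theorem ncard_singleton_mul_diff (g : G) (U : Finset G) :
    ((((({g} : Finset G) : Set G) * (U : Set G)) \ (U : Set G)).ncard) = exitCount g U := by
  classical
  have h : ((({g} : Finset G) : Set G) * (U : Set G)) \ (U : Set G) =
      (((U.filter fun y => g * y ∉ U).image fun y => g * y : Finset G) : Set G) := by
    ext z
    simp only [Finset.coe_singleton, Set.singleton_mul, Set.mem_sdiff, Set.mem_image,
      Finset.mem_coe, Finset.coe_image, Finset.mem_filter]
    constructor
    · rintro ⟨⟨y, hy, rfl⟩, h⟩
      exact ⟨y, ⟨hy, h⟩, rfl⟩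
    · rintro ⟨y, ⟨hy, h⟩, rfl⟩
      exact ⟨⟨y, hy, rfl⟩, h⟩
  rw [h, Set.ncard_coe_finset, Finset.card_image_of_injective _ (mul_right_injective g), exitCount]

theorem IsFolner.tendsto_exitCount {Q : ℕ → Finset G} (hQ : IsFolner Q) (g : G) :
    Tendsto (fun n => (exitCount g (Q n) : ℝ) / (Q n).card) atTop (𝓝 0) := by
  simpa only [ncard_singleton_mul_diff] using hQ {g}

open Classical in
/-- The set of all `x` with `V x ⊆ U`, for nonempty `V`. -/
def translatesIn (V U : Finset G) : Finset G :=
  (V.biUnion fun v => U.image fun y => v⁻¹ * y).filter fun x => ∀ a ∈ V, a * x ∈ U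

theorem mem_translatesIn {V U : Finset G} (hV : V.Nonempty) {x : G} :
    x ∈ translatesIn V U ↔ ∀ a ∈ V, a * x ∈ U := by
  classical
  simp only [translatesIn, Finset.mem_filter, Finset.mem_biUnion, Finset.mem_image,
    and_iff_right_iff_imp]
  obtain ⟨v, hv⟩ := hV
  exact fun h => ⟨v, hv, v * x, h v hv, by group⟩

theorem card_translatesIn_le {V U : Finset G} (hV : V.Nonempty) :
    (translatesIn V U).card ≤ U.card := by
  obtain ⟨v, hv⟩ := hV
  exact Finset.card_le_card_of_injOn (fun x => v * x)
    (fun x hx => (mem_translatesIn ⟨v, hv⟩).1 hx v hv) (mul_right_injective v).injOn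

/-- A point `y = v x` of `U` for which `V x` is not contained in `U` has some `a ∈ V` with `a v⁻¹ y
∉ U`, and is counted by that exit count. -/
theorem card_le_card_translatesIn_add {V U : Finset G} {v : G} (hv : v ∈ V) :
    U.card ≤ (translatesIn V U).card + ∑ a ∈ V, exitCount (a * v⁻¹) U := by
  classical
  have h : U ⊆ (translatesIn V U).image (fun x => v * x) ∪
      V.biUnion fun a => U.filter fun y => a * v⁻¹ * y ∉ U := by
    intro y hy
    by_cases h : ∃ a ∈ V, a * v⁻¹ * y ∉ U
    · obtain ⟨a, ha, hay⟩ := h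
      exact Finset.mem_union_right _ (Finset.mem_biUnion.2 ⟨a, ha, Finset.mem_filter.2 ⟨hy, hay⟩⟩)
    · push Not at h
      refine Finset.mem_union_left _ (Finset.mem_image.2 ⟨v⁻¹ * y, ?_, by group⟩)
      exact (mem_translatesIn ⟨v, hv⟩).2 fun a ha => by simpa [mul_assoc] using h a ha
  refine (Finset.card_le_card h).trans ((Finset.card_union_le _ _).trans ?_)
  exact Nat.add_le_add Finset.card_image_le Finset.card_biUnion_le

theorem IsFolner.tendsto_card_translatesIn {Q : ℕ → Finset G} (hQ : IsFolner Q)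
    (hne : ∀ n, (Q n).Nonempty) {V : Finset G} (hV : V.Nonempty) :
    Tendsto (fun n => ((translatesIn V (Q n)).card : ℝ) / (Q n).card) atTop (𝓝 1) := by
  obtain ⟨v, hv⟩ := hV
  have hpos : ∀ n, (0 : ℝ) < (Q n).card := fun n => by exact_mod_cast (hne n).card_pos
  have h0 : Tendsto (fun n => 1 - ∑ a ∈ V, (exitCount (a * v⁻¹) (Q n) : ℝ) / (Q n).card) atTop
      (𝓝 1) := by
    simpa using (tendsto_finsetSum V fun a _ => hQ.tendsto_exitCount (a * v⁻¹)).const_sub 1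
  refine tendsto_of_tendsto_of_tendsto_of_le_of_le h0 tendsto_const_nhds (fun n => ?_) fun n => ?_
  · rw [← Finset.sum_div, le_div_iff₀ (hpos n), sub_mul, div_mul_cancel₀ _ (hpos n).ne', one_mul,
      sub_le_iff_le_add]
    exact_mod_cast card_le_card_translatesIn_add hv
  · exact (div_le_one (hpos n)).2 (by exact_mod_cast card_translatesIn_le ⟨v, hv⟩)

/-- The expected number of open edges leaving `U`. -/
def EdgeParameter.boundaryWeight (P : EdgeParameter G) (U : Finset G) : ℝ :=
  ∑' g, P.p g * exitCount g U

theorem EdgeParameter.summable_mul_exitCount (P : EdgeParameter G) (U : Finset G) :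
    Summable fun g => P.p g * exitCount g U := by
  refine Summable.of_nonneg_of_le (fun g => mul_nonneg (P.nonneg g) (Nat.cast_nonneg _))
    (fun g => ?_) (P.summable.mul_right (U.card : ℝ))
  exact mul_le_mul_of_nonneg_left (by exact_mod_cast exitCount_le g U) (P.nonneg g)

theorem IsFolner.tendsto_boundaryWeight {Q : ℕ → Finset G} (hQ : IsFolner Q)
    (P : EdgeParameter G) :
    Tendsto (fun n => P.boundaryWeight (Q n) / (Q n).card) atTop (𝓝 0) := by
  have h : Tendsto (fun n => ∑' g, P.p g * ((exitCount g (Q n) : ℝ) / (Q n).card)) atTop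
      (𝓝 (∑' g, P.p g * 0)) := by
    -- Dominated by `p`, because `exitCount g (Q n) ≤ |Q n|`.
    refine tendsto_tsum_of_dominated_convergence P.summable
      (fun g => (hQ.tendsto_exitCount g).const_mul _) (Eventually.of_forall fun n g => ?_)
    rw [Real.norm_eq_abs, abs_of_nonneg (mul_nonneg (P.nonneg g) (by positivity))]
    refine mul_le_of_le_one_right (P.nonneg g) (div_le_one_of_le₀ ?_ (Nat.cast_nonneg _))
    exact_mod_cast exitCount_le g (Q n)
  simp only [mul_zero, tsum_zero] at h
  refine h.congr fun n => ?_
  rw [EdgeParameter.boundaryWeight, ← tsum_div_const]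
  exact tsum_congr fun g => by ring

/-! ### Colorings by separated classes -/

/-- Greedy colouring along an enumeration of `α`: each element avoids the colours of its earlier
neighbours. -/
theorem exists_coloring_of_finite_relation {α : Type*} [Countable α] {k : ℕ} (N : α → Finset α)
    (hN : ∀ x, (N x).card ≤ k) :
    ∃ c : α → Fin (k + 1), ∀ x y, x ≠ y → y ∈ N x → x ∈ N y → c x ≠ c y := by
  classical
  obtain ⟨enc, henc⟩ := exists_injective_nat α
  let F : ∀ x, (∀ y, enc y < enc x → Fin (k + 1)) → Fin (k + 1) := fun x f =>
    if h : ∃ i, ∀ y (hy : enc y < enc x), y ∈ N x → f y hy ≠ i then h.choose else 0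
  let c : α → Fin (k + 1) := (measure enc).wf.fix F
  have hc : ∀ x y, enc y < enc x → y ∈ N x → c y ≠ c x := by
    intro x
    -- At most `k` colours are forbidden, and `k + 1` are available.
    have hx : ∃ i, ∀ y (_ : enc y < enc x), y ∈ N x → c y ≠ i := by
      by_contra! h
      have hsub : (Finset.univ : Finset (Fin (k + 1))) ⊆ (N x).image c := by
        intro i _
        obtain ⟨y, -, hy, hi⟩ := h i
        exact Finset.mem_image.2 ⟨y, hy, hi⟩
      have := (Finset.card_le_card hsub).trans (Finset.card_image_le.trans (hN x))
      simp at this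
    have hcx : c x = hx.choose := by
      have : c x = F x fun y _ => c y := (measure enc).wf.fix_eq F x
      rw [this]
      exact dif_pos hx
    intro y hy hyx
    rw [hcx]
    exact hx.choose_spec y hy hyx
  refine ⟨c, fun x y hxy hy hx => ?_⟩
  rcases lt_or_gt_of_ne (henc.ne hxy) with h | h
  · exact hc y x h hx
  · exact (hc x y h hy).symm

/-- `V x` and `V y` intersect only if `y ∈ V⁻¹ V x`, so every translate conflicts with boundedly
many others. -/
theorem exists_coloring_pairwiseDisjoint [Countable G] (V : Finset G) :
    ∃ (k : ℕ) (c : G → Fin k), ∀ i, (c ⁻¹' {i}).PairwiseDisjoint fun t => (V : Set G) * {t} := by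
  classical
  obtain ⟨c, hc⟩ := exists_coloring_of_finite_relation
    (fun x : G => (V⁻¹ * V).image fun g => g * x) (fun x => Finset.card_image_le)
  refine ⟨_, c, fun i x hx y hy hxy => ?_⟩
  rw [Function.onFun, Set.mul_singleton, Set.mul_singleton, Set.disjoint_left]
  rintro z ⟨a, ha, rfl⟩ ⟨b, hb, hab⟩
  have hab : b * y = a * x := hab
  refine hc x y hxy ?_ ?_ (hx.trans hy.symm)
  · refine Finset.mem_image.2 ⟨b⁻¹ * a, Finset.mul_mem_mul (Finset.inv_mem_inv hb) ha, ?_⟩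
    rw [mul_assoc, ← hab]
    group
  · refine Finset.mem_image.2 ⟨a⁻¹ * b, Finset.mul_mem_mul (Finset.inv_mem_inv ha) hb, ?_⟩
    rw [mul_assoc, hab]
    group

/-! ### Pattern frequencies -/

theorem card_filter_subtype {α : Type*} (s : Finset α) (p q : α → Prop) [DecidablePred p]
    [DecidablePred q] [DecidablePred fun x : Subtype p => q x] :
    ((s.subtype p).filter fun x : Subtype p => q x).card = ((s.filter q).filter p).card := by
  refine Eq.trans (congrArg Finset.card ?_) (Finset.card_subtype p (s.filter q))
  ext x
  simp

open Classical in
theorem occurrences_eq {V : Finset G} (hV : V.Nonempty) (S : SimpleGraph V) (ω : Config G)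
    (U : Finset G) :
    occurrences S (percolationGraph ω) U =
      ((translatesIn V U).filter fun x => ω ∈ patternEvent S x).card := by
  rw [occurrences, ← Set.ncard_coe_finset]
  congr 1
  ext x
  rw [Finset.mem_coe, Finset.mem_filter, mem_translatesIn hV]
  exact and_congr_left' Subtype.forall

theorem IsFolner.ae_tendsto_occurrences [Countable G] {Q : ℕ → Finset G} (hQ : IsFolner Q)
    (hcard : ∀ n, n < (Q n).card) (P : EdgeParameter G) {V : Finset G} (hV : V.Nonempty)
    (S : SimpleGraph V) :
    ∀ᵐ ω ∂P.measure, Tendsto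
      (fun j => (occurrences S (percolationGraph ω) (Q j) : ℝ) / ((Q j).card : ℝ))
      atTop (𝓝 (P.frequency S)) := by
  classical
  have hne : ∀ n, (Q n).Nonempty := fun n => Finset.card_pos.1 ((Nat.zero_le n).trans_lt (hcard n))
  obtain ⟨k, c, hc⟩ := exists_coloring_pairwiseDisjoint V
  have h1 : ∀ᵐ ω ∂P.measure, ∀ i : Fin k, Tendsto (fun j =>
      (((((translatesIn V (Q j)).subtype (· ∈ c ⁻¹' {i})).filter
        fun t : (c ⁻¹' {i} : Set G) => ω ∈ patternEvent S (t : G)).card : ℝ) -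
        P.frequency S * ((translatesIn V (Q j)).subtype (· ∈ c ⁻¹' {i})).card) / (Q j).card)
        atTop (𝓝 0) := by
    rw [ae_all_iff]
    intro i
    refine P.ae_tendsto_pattern_sub S (hc i)
      (fun j => (translatesIn V (Q j)).subtype (· ∈ c ⁻¹' {i})) (fun j => (Q j).card)
        (fun j => ?_) hcard
    change ((translatesIn V (Q j)).subtype (· ∈ c ⁻¹' {i})).card ≤ _
    rw [Finset.card_subtype]
    exact (Finset.card_filter_le _ _).trans (card_translatesIn_le hV)
  filter_upwards [h1] with ω hω
  -- Summing over the colours recovers all translates of `V` inside `Q j`, and their number is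
  -- asymptotic to `|Q j|`.
  have h2 := (tendsto_finsetSum Finset.univ fun i _ => hω i).add
    ((hQ.tendsto_card_translatesIn hne hV).const_mul (P.frequency S))
  simp only [Finset.sum_const_zero, zero_add, mul_one] at h2
  refine h2.congr fun j => ?_
  have hfib : ∀ s : Finset G, ∑ i : Fin k, ((s.filter (· ∈ c ⁻¹' {i})).card : ℝ) = s.card := by
    intro s
    rw [Finset.card_eq_sum_card_fiberwise (f := c) (t := Finset.univ) fun _ _ => by simp]
    push_cast
    refine Finset.sum_congr rfl fun i _ => ?_
    congr 2
    ext x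
    simp
  have hsub : ∀ i : Fin k, (((translatesIn V (Q j)).subtype (· ∈ c ⁻¹' {i})).filter
        fun t : (c ⁻¹' {i} : Set G) => ω ∈ patternEvent S (t : G)).card =
      (((translatesIn V (Q j)).filter fun x => ω ∈ patternEvent S x).filter
        (· ∈ c ⁻¹' {i})).card := fun i =>
    card_filter_subtype (translatesIn V (Q j)) (· ∈ c ⁻¹' {i}) fun x => ω ∈ patternEvent S x
  simp only [hsub, Finset.card_subtype]
  rw [← Finset.sum_div, Finset.sum_sub_distrib, ← Finset.mul_sum, hfib, hfib, occurrences_eq hV]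
  ring

end Folner

/-! ### Comparison of the restricted Laplacian with the Laplacians of disjoint tiles -/

section Tiles

variable {G : Type*}

theorem inclusion_apply (U : Finset G) (u : EuclideanSpace ℂ U) (x : U) :
    inclusion U u x = u x := by
  simp [inclusion]

/-- The full degree on the diagonal means that a neighbour outside `U` contributes `u x - 0`; with
extension by zero, the restricted operator is a sum of differences over all neighbours. -/
theorem restrictedLaplacian_eq_sum (Γ : SimpleGraph G) (U : Finset G) (u : EuclideanSpace ℂ U)
    (x : U) (h : (Γ.neighborSet (x : G)).Finite) :
    restrictedLaplacian Γ U u x = ∑ y ∈ h.toFinset, (u x - inclusion U u y) := by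
  classical
  change laplacian Γ (inclusion U u) x = _
  rw [laplacian_apply, inclusion_apply, Finset.sum_sub_distrib, Finset.sum_const, nsmul_eq_mul,
    ← Set.ncard_eq_toFinset_card _ h]
  congr 1
  refine Finset.sum_subset_zero_on_sdiff (fun y hy => ?_) (fun y hy => ?_) fun _ _ => rfl
  · simpa using (Finset.mem_filter.1 hy).2
  · rw [Finset.mem_sdiff, Finset.mem_filter] at hy
    by_contra h0
    exact hy.2 ⟨Finsupp.mem_support_iff.2 h0, by simpa using hy.1⟩

/-- The differences of a function along the edges in `C`. -/
def edgeDifferences (U : Finset G) (C : Finset (Edge G)) :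
    EuclideanSpace ℂ U →ₗ[ℂ] (C → ℂ) where
  -- For an edge leaving `U` the outer value is zero, so the condition forces `u` to vanish at the
  -- inner endpoint. The arbitrary orientation of the edge does not affect the kernel.
  toFun u e := inclusion U u (Quot.out e.1.1).1 - inclusion U u (Quot.out e.1.1).2
  map_add' u v := by
    funext e
    simp only [map_add, Finsupp.add_apply, Pi.add_apply]
    ring
  map_smul' c u := by
    funext e
    simp only [map_smul, Finsupp.smul_apply, Pi.smul_apply, smul_eq_mul, RingHom.id_apply]
    ring

theorem inclusion_eq_of_edgeDifferences_eq_zero {U : Finset G} {C : Finset (Edge G)}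
    {u : EuclideanSpace ℂ U}
    (hu : edgeDifferences U C u = 0) {e : Edge G} (he : e ∈ C) {x y : G} (hxy : e.1 = s(x, y)) :
    inclusion U u x = inclusion U u y := by
  have h : inclusion U u (Quot.out e.1).1 - inclusion U u (Quot.out e.1).2 = 0 :=
    congrFun hu ⟨e, he⟩
  have ho : s((Quot.out e.1).1, (Quot.out e.1).2) = s(x, y) := (Quot.out_eq e.1).trans hxy
  rw [sub_eq_zero] at h
  rcases Sym2.eq_iff.1 ho with ⟨h1, h2⟩ | ⟨h1, h2⟩
  · rwa [h1, h2] at h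
  · rw [h1, h2] at h
    exact h.symm

variable [Group G]

/-- The edges with an endpoint in `U` that are not contained in one of the tiles `V t`, `t ∈ T`. -/
def crossingEdges (V T U : Finset G) : Set (Edge G) :=
  {e | (∃ x ∈ U, x ∈ e.1) ∧ ¬ ∃ t ∈ T, ∀ x ∈ e.1, x * t⁻¹ ∈ V}

/-- The graph on `V` that corresponds to the graph induced by `Γ` on `V t`. -/
def tilePattern (V : Finset G) (Γ : SimpleGraph G) (t : G) : SimpleGraph V :=
  Γ.comap fun a : V => (a : G) * t

theorem mem_patternEvent_iff {V : Finset G} (S : SimpleGraph V) (t : G) (ω : Config G) :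
    ω ∈ patternEvent S t ↔ tilePattern V (percolationGraph ω) t = S := by
  constructor
  · intro h
    ext a b
    exact h a b
  · rintro rfl a b
    exact Iff.rfl

variable {V T U : Finset G}

/-- The point `a t` of the tile `V t ⊆ U`. -/
def tilePoint (hTU : ∀ t ∈ T, ∀ a ∈ V, a * t ∈ U) (i : T × V) : U :=
  ⟨(i.2 : G) * (i.1 : G), hTU _ i.1.2 _ i.2.2⟩

theorem eq_of_mem_tile (hT : (T : Set G).PairwiseDisjoint fun t => (V : Set G) * {t}) {x t s : G}
    (ht : t ∈ T) (hs : s ∈ T) (hxt : x * t⁻¹ ∈ V) (hxs : x * s⁻¹ ∈ V) : t = s := by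
  by_contra hne
  refine Set.disjoint_left.1 (hT ht hs hne) (?_ : x ∈ (V : Set G) * {t}) ?_
  · exact ⟨x * t⁻¹, hxt, t, rfl, by simp⟩
  · exact ⟨x * s⁻¹, hxs, s, rfl, by simp⟩

theorem tilePoint_injective (hT : (T : Set G).PairwiseDisjoint fun t => (V : Set G) * {t})
    (hTU : ∀ t ∈ T, ∀ a ∈ V, a * t ∈ U) : Function.Injective (tilePoint hTU) := by
  rintro ⟨⟨t, ht⟩, a, ha⟩ ⟨⟨s, hs⟩, b, hb⟩ h
  have h1 : a * t = b * s := congrArg Subtype.val h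
  obtain rfl : t = s := eq_of_mem_tile hT (x := a * t) ht hs (by simpa using ha)
    (by rw [h1]; simpa using hb)
  obtain rfl : a = b := mul_right_cancel h1
  rfl

/-- The function on `U` which is given by `w t` on the tile `V t` and which is zero outside the
tiles. -/
def glueTiles (hTU : ∀ t ∈ T, ∀ a ∈ V, a * t ∈ U) :
    (T → EuclideanSpace ℂ V) →ₗ[ℂ] EuclideanSpace ℂ U where
  toFun w := WithLp.toLp 2 (Function.extend (tilePoint hTU) (fun i => w i.1 i.2) 0)
  map_add' w w' := by
    rw [← WithLp.toLp_add, ← Function.extend_add, add_zero]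
    rfl
  map_smul' c w := by
    rw [RingHom.id_apply, ← WithLp.toLp_smul, ← Function.extend_smul, smul_zero]
    rfl

theorem glueTiles_tilePoint (hT : (T : Set G).PairwiseDisjoint fun t => (V : Set G) * {t})
    (hTU : ∀ t ∈ T, ∀ a ∈ V, a * t ∈ U) (w : T → EuclideanSpace ℂ V) (i : T × V) :
    glueTiles hTU w (tilePoint hTU i) = w i.1 i.2 :=
  (tilePoint_injective hT hTU).extend_apply (fun i => w i.1 i.2) 0 i

theorem glueTiles_of_notMem_range (hTU : ∀ t ∈ T, ∀ a ∈ V, a * t ∈ U)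
    (w : T → EuclideanSpace ℂ V) {x : U} (hx : x ∉ Set.range (tilePoint hTU)) :
    glueTiles hTU w x = 0 :=
  Function.extend_apply' (fun i : T × V => w i.1 i.2) (0 : U → ℂ) x hx

theorem sum_tiles_eq {M : Type*} [AddCommMonoid M]
    (hT : (T : Set G).PairwiseDisjoint fun t => (V : Set G) * {t})
    (hTU : ∀ t ∈ T, ∀ a ∈ V, a * t ∈ U) (F : U → M)
    (hF : ∀ x ∉ Set.range (tilePoint hTU), F x = 0) :
    ∑ x, F x = ∑ t : T, ∑ a : V, F (tilePoint hTU (t, a)) := by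
  rw [← Fintype.sum_prod_type' fun t a => F (tilePoint hTU (t, a))]
  exact (Fintype.sum_of_injective _ (tilePoint_injective hT hTU) _ F hF fun _ => rfl).symm

theorem norm_glueTiles_sq (hT : (T : Set G).PairwiseDisjoint fun t => (V : Set G) * {t})
    (hTU : ∀ t ∈ T, ∀ a ∈ V, a * t ∈ U) (w : T → EuclideanSpace ℂ V) :
    ‖glueTiles hTU w‖ ^ 2 = ∑ t, ‖w t‖ ^ 2 := by
  rw [EuclideanSpace.norm_sq_eq, sum_tiles_eq hT hTU _ fun x hx => by
    rw [glueTiles_of_notMem_range hTU w hx]; simp]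
  refine Finset.sum_congr rfl fun t _ => ?_
  rw [EuclideanSpace.norm_sq_eq]
  exact Finset.sum_congr rfl fun a _ => by rw [glueTiles_tilePoint hT]

theorem restrictedLaplacian_glueTiles (Γ : SimpleGraph G)
    (hΓ : ∀ x, (Γ.neighborSet x).Finite)
    (hT : (T : Set G).PairwiseDisjoint fun t => (V : Set G) * {t})
    (hTU : ∀ t ∈ T, ∀ a ∈ V, a * t ∈ U) {C : Finset (Edge G)}
    (hC : ∀ e ∈ crossingEdges V T U, e.1 ∈ Γ.edgeSet → e ∈ C) (w : T → EuclideanSpace ℂ V)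
    (hw : edgeDifferences U C (glueTiles hTU w) = 0) (t : T) (a : V) :
    restrictedLaplacian Γ U (glueTiles hTU w) (tilePoint hTU (t, a)) =
      finiteLaplacian (tilePattern V Γ t) (w t) a := by
  classical
  set u := glueTiles hTU w
  have hx : ((tilePoint hTU (t, a) : U) : G) = a * t := rfl
  rw [restrictedLaplacian_eq_sum Γ U u _ (hΓ _)]
  change _ = ∑ b : V with (tilePattern V Γ t).Adj a b, (w t a - w t b)
  refine (Finset.sum_of_injOn (fun b : V => (b : G) * (t : G)) ?_ ?_ ?_ ?_).symm
  · exact fun b _ c _ h => Subtype.ext (mul_right_cancel h)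
  · intro b hb
    simpa [tilePattern, hx] using hb
  -- A neighbour outside the tile `V t` is joined to `a t` by an open crossing edge, so its
  -- difference vanishes by `hw`.
  · intro y hy hy'
    rw [Set.Finite.mem_toFinset, SimpleGraph.mem_neighborSet, hx] at hy
    rw [sub_eq_zero, ← inclusion_apply U u, hx]
    refine inclusion_eq_of_edgeDifferences_eq_zero hw (e := ⟨s((a : G) * t, y), ?_⟩)
      (hC _ ⟨⟨(a : G) * t, hTU _ t.2 _ a.2, Sym2.mem_mk_left _ _⟩, ?_⟩ hy) rfl
    · simpa using hy.ne
    · rintro ⟨s, hs, hst⟩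
      have h1 := hst _ (Sym2.mem_mk_left _ _)
      have h2 := hst _ (Sym2.mem_mk_right _ _)
      have hts : (t : G) = s := eq_of_mem_tile hT t.2 hs (x := a * t) (by simp) h1
      rw [← hts] at h2
      refine hy' ⟨⟨y * (t : G)⁻¹, h2⟩, ?_, by simp⟩
      simpa [tilePattern] using hy
  · intro b _
    rw [← glueTiles_tilePoint hT hTU w (t, b), ← glueTiles_tilePoint hT hTU w (t, a),
      ← inclusion_apply U _ (tilePoint hTU (t, b))]
    rfl

theorem inner_restrictedLaplacian_glueTiles (Γ : SimpleGraph G)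
    (hΓ : ∀ x, (Γ.neighborSet x).Finite)
    (hT : (T : Set G).PairwiseDisjoint fun t => (V : Set G) * {t})
    (hTU : ∀ t ∈ T, ∀ a ∈ V, a * t ∈ U) {C : Finset (Edge G)}
    (hC : ∀ e ∈ crossingEdges V T U, e.1 ∈ Γ.edgeSet → e ∈ C) (w : T → EuclideanSpace ℂ V)
    (hw : edgeDifferences U C (glueTiles hTU w) = 0) :
    (inner ℂ (restrictedLaplacian Γ U (glueTiles hTU w)) (glueTiles hTU w)).re =
      ∑ t : T, (inner ℂ (finiteLaplacian (tilePattern V Γ t) (w t)) (w t)).re := by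
  rw [← Complex.re_sum, PiLp.inner_apply, sum_tiles_eq hT hTU _ fun x hx => by
    rw [glueTiles_of_notMem_range hTU w hx, inner_zero_right]]
  congr 1
  refine Finset.sum_congr rfl fun t _ => ?_
  rw [PiLp.inner_apply]
  refine Finset.sum_congr rfl fun a _ => ?_
  rw [restrictedLaplacian_glueTiles Γ hΓ hT hTU hC w hw, glueTiles_tilePoint hT]

theorem sum_finiteCount_le (Γ : SimpleGraph G) (hΓ : ∀ x, (Γ.neighborSet x).Finite)
    (hT : (T : Set G).PairwiseDisjoint fun t => (V : Set G) * {t})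
    (hTU : ∀ t ∈ T, ∀ a ∈ V, a * t ∈ U) {C : Finset (Edge G)}
    (hC : ∀ e ∈ crossingEdges V T U, e.1 ∈ Γ.edgeSet → e ∈ C) (E : ℝ) :
    ∑ t : T, finiteCount (tilePattern V Γ t) E ≤ restrictedCount Γ U E + C.card := by
  have h := sum_eigenvalueCount_le _ (restrictedLaplacian_isSymmetric Γ U) _
    (fun t : T => finiteLaplacian_isSymmetric (tilePattern V Γ t)) (glueTiles hTU)
    (norm_glueTiles_sq hT hTU) (edgeDifferences U C)
    (inner_restrictedLaplacian_glueTiles Γ hΓ hT hTU hC) E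
  rwa [Fintype.card_coe] at h

theorem restrictedCount_add_le (Γ : SimpleGraph G) (hΓ : ∀ x, (Γ.neighborSet x).Finite)
    (hT : (T : Set G).PairwiseDisjoint fun t => (V : Set G) * {t})
    (hTU : ∀ t ∈ T, ∀ a ∈ V, a * t ∈ U) {C : Finset (Edge G)}
    (hC : ∀ e ∈ crossingEdges V T U, e.1 ∈ Γ.edgeSet → e ∈ C) (E : ℝ) :
    restrictedCount Γ U E + T.card * V.card ≤
      ∑ t : T, finiteCount (tilePattern V Γ t) E + U.card + C.card := by
  have h := eigenvalueCount_le_sum _ (restrictedLaplacian_isSymmetric Γ U) _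
    (fun t : T => finiteLaplacian_isSymmetric (tilePattern V Γ t)) (glueTiles hTU)
    (norm_glueTiles_sq hT hTU) (edgeDifferences U C)
    (inner_restrictedLaplacian_glueTiles Γ hΓ hT hTU hC) E
  simp only [Fintype.card_coe, finrank_euclideanSpace] at h
  exact h

end Tiles

/-! ### The expected number of open crossing edges -/

section Crossing

variable {G : Type*} [Group G] (P : EdgeParameter G) {V T U : Finset G}

open Classical in
/-- The weight `p(g)` of the edge `[x, g x]` if this edge is not contained in a tile `V t`,
`t ∈ T`. -/
def EdgeParameter.crossingWeight (P : EdgeParameter G) (V T : Finset G) (x g : G) : ℝ :=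
  if ∃ t ∈ T, x * t⁻¹ ∈ V ∧ g * x * t⁻¹ ∈ V then 0 else P.p g

theorem EdgeParameter.crossingWeight_nonneg (x g : G) : 0 ≤ P.crossingWeight V T x g := by
  unfold EdgeParameter.crossingWeight
  split_ifs
  exacts [le_rfl, P.nonneg g]

theorem EdgeParameter.crossingWeight_le (x g : G) : P.crossingWeight V T x g ≤ P.p g := by
  unfold EdgeParameter.crossingWeight
  split_ifs
  exacts [P.nonneg g, le_rfl]

theorem EdgeParameter.summable_crossingWeight (x : G) : Summable (P.crossingWeight V T x) :=
  Summable.of_nonneg_of_le (P.crossingWeight_nonneg x) (P.crossingWeight_le x) P.summable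

-- The edges at `x` are written `[x, g x]`; such an edge has probability `p(g⁻¹) = p(g)`,
-- independent of `x`.
open Classical in
theorem EdgeParameter.sum_prob_mem_le (x : G) (F : Finset (Edge G))
    (hF : (F : Set (Edge G)) ⊆ crossingEdges V T U) :
    ∑ e ∈ F with x ∈ e.1, (P.prob e.1 : ℝ) ≤ ∑' g, P.crossingWeight V T x g := by
  have hother : ∀ e : Edge G, x ∈ e.1 → ∃ g, e.1 = s(x, g * x) := by
    rintro ⟨e, he⟩ ⟨y, rfl⟩
    exact ⟨y * x⁻¹, by simp⟩
  choose! γ hγ using hother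
  have hinj : Set.InjOn γ (F.filter fun e => x ∈ e.1) := by
    intro e he e' he' h
    have h1 := hγ e (Finset.mem_filter.1 he).2
    have h2 := hγ e' (Finset.mem_filter.1 he').2
    exact Subtype.ext (by rw [h1, h2, h])
  calc ∑ e ∈ F with x ∈ e.1, (P.prob e.1 : ℝ)
      = ∑ e ∈ F with x ∈ e.1, P.crossingWeight V T x (γ e) := by
        refine Finset.sum_congr rfl fun e he => ?_
        obtain ⟨heF, hxe⟩ := Finset.mem_filter.1 he
        have hnot : ¬ ∃ t ∈ T, x * t⁻¹ ∈ V ∧ γ e * x * t⁻¹ ∈ V := by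
          rintro ⟨t, ht, h1, h2⟩
          refine (hF heF).2 ⟨t, ht, fun z hz => ?_⟩
          rw [hγ e hxe, Sym2.mem_iff] at hz
          rcases hz with rfl | rfl
          exacts [h1, h2]
        rw [EdgeParameter.crossingWeight, if_neg hnot, hγ e hxe]
        change P.p (x * (γ e * x)⁻¹) = P.p (γ e)
        rw [← P.symm (γ e)]
        congr 1
        group
    _ = ∑ g ∈ (F.filter fun e => x ∈ e.1).image γ, P.crossingWeight V T x g :=
        (Finset.sum_image hinj).symm
    _ ≤ ∑' g, P.crossingWeight V T x g :=
        (P.summable_crossingWeight x).sum_le_tsum _ fun g _ => P.crossingWeight_nonneg x g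

/-- Every crossing edge is charged to each of its endpoints in `U`, and there is at least one. -/
theorem EdgeParameter.sum_prob_le_sum_crossingWeight (F : Finset (Edge G))
    (hF : (F : Set (Edge G)) ⊆ crossingEdges V T U) :
    ∑ e ∈ F, (P.prob e.1 : ℝ) ≤ ∑ x : U, ∑' g, P.crossingWeight V T x g := by
  classical
  calc ∑ e ∈ F, (P.prob e.1 : ℝ)
      ≤ ∑ e ∈ F, ∑ x : U, if (x : G) ∈ e.1 then (P.prob e.1 : ℝ) else 0 := by
        refine Finset.sum_le_sum fun e he => ?_
        obtain ⟨x, hxU, hxe⟩ := (hF he).1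
        have h := Finset.single_le_sum (f := fun x : U => if (x : G) ∈ e.1 then
          (P.prob e.1 : ℝ) else 0) (fun y _ => by
            split_ifs
            exacts [(P.prob e.1).2.1, le_rfl]) (Finset.mem_univ (⟨x, hxU⟩ : U))
        simpa only [hxe, if_true] using h
    _ = ∑ x : U, ∑ e ∈ F with (x : G) ∈ e.1, (P.prob e.1 : ℝ) := by
        rw [Finset.sum_comm]
        simp only [Finset.sum_filter]
    _ ≤ ∑ x : U, ∑' g, P.crossingWeight V T x g :=
        Finset.sum_le_sum fun x _ => P.sum_prob_mem_le x F hF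

theorem EdgeParameter.sum_crossingWeight_tile_le (t : G) (ht : t ∈ T) :
    ∑ a : V, ∑' g, P.crossingWeight V T ((a : G) * t) g ≤ P.boundaryWeight V := by
  classical
  rw [EdgeParameter.boundaryWeight,
    ← Summable.tsum_finsetSum fun (a : V) _ => P.summable_crossingWeight ((a : G) * t)]
  refine Summable.tsum_le_tsum (fun g => ?_)
    (summable_sum fun (a : V) _ => P.summable_crossingWeight ((a : G) * t))
    (P.summable_mul_exitCount V)
  rw [exitCount, mul_comm, ← nsmul_eq_mul, ← Finset.sum_const, Finset.sum_filter,
    ← Finset.sum_coe_sort V]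
  refine Finset.sum_le_sum fun a _ => ?_
  by_cases h : g * (a : G) ∈ V
  · rw [EdgeParameter.crossingWeight, if_pos ⟨t, ht, by simp, by simpa [mul_assoc] using h⟩]
    simp [h]
  · simpa [h] using P.crossingWeight_le ((a : G) * t) g

theorem card_mul_card_le (hT : (T : Set G).PairwiseDisjoint fun t => (V : Set G) * {t})
    (hTU : ∀ t ∈ T, ∀ a ∈ V, a * t ∈ U) : T.card * V.card ≤ U.card := by
  simpa using Fintype.card_le_of_injective _ (tilePoint_injective hT hTU)

theorem EdgeParameter.sum_prob_crossingEdges_le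
    (hT : (T : Set G).PairwiseDisjoint fun t => (V : Set G) * {t})
    (hTU : ∀ t ∈ T, ∀ a ∈ V, a * t ∈ U) (F : Finset (Edge G))
    (hF : (F : Set (Edge G)) ⊆ crossingEdges V T U) :
    ∑ e ∈ F, (P.prob e.1 : ℝ) ≤
      T.card * P.boundaryWeight V + (U.card - T.card * V.card) * ∑' g, P.p g := by
  classical
  set p₁ := ∑' g, P.p g
  set B : U → ℝ := fun x => ∑' g, P.crossingWeight V T x g
  -- Since the terms `B x - p₁` are nonpositive, dropping the points outside the tiles can only
  -- increase their sum. This charges `p₁` to each uncovered point.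
  have hB : ∀ x, B x - p₁ ≤ 0 := fun x => sub_nonpos.2
    (Summable.tsum_le_tsum (P.crossingWeight_le _) (P.summable_crossingWeight _) P.summable)
  have h1 : ∑ x, (B x - p₁) ≤ ∑ x, if x ∈ Set.range (tilePoint hTU) then B x - p₁ else 0 := by
    refine Finset.sum_le_sum fun x _ => ?_
    split_ifs
    exacts [le_rfl, hB x]
  rw [sum_tiles_eq hT hTU _ fun x hx => if_neg hx] at h1
  simp only [Set.mem_range_self, if_true, Finset.sum_sub_distrib, Finset.sum_const,
    Finset.card_univ, Fintype.card_coe, nsmul_eq_mul] at h1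
  have h2 : ∑ t : T, ∑ a : V, B (tilePoint hTU (t, a)) ≤ T.card * P.boundaryWeight V := by
    rw [← nsmul_eq_mul, ← Fintype.card_coe T, ← Finset.card_univ, ← Finset.sum_const]
    exact Finset.sum_le_sum fun t _ => P.sum_crossingWeight_tile_le (t : G) t.2
  have h3 := P.sum_prob_le_sum_crossingWeight F hF
  change _ ≤ ∑ x, B x at h3
  linarith

end Crossing

theorem finiteCount_le {V : Type*} [Fintype V] (S : SimpleGraph V) (E : ℝ) :
    finiteCount S E ≤ Fintype.card V := by
  have h := eigenvalueCount_le _ (finiteLaplacian_isSymmetric S) E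
  rwa [finrank_euclideanSpace] at h

/-! ### Almost sure comparison with the averaged counting functions -/

section Comparison

variable {G : Type*} [Group G]

open Classical in
/-- The translations `t ∈ D` with `V t ⊆ U`. -/
def tilesIn (V U : Finset G) (D : Set G) : Finset G :=
  (translatesIn V U).filter (· ∈ D)

theorem mem_tilesIn {V U : Finset G} {D : Set G} (hV : V.Nonempty) {t : G} :
    t ∈ tilesIn V U D ↔ (∀ a ∈ V, a * t ∈ U) ∧ t ∈ D := by
  classical
  rw [tilesIn, Finset.mem_filter, mem_translatesIn hV]

theorem pairwiseDisjoint_tilesIn {V U : Finset G} {D : Set G} (hV : V.Nonempty)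
    (hD : D.PairwiseDisjoint fun t => (V : Set G) * {t}) :
    (tilesIn V U D : Set G).PairwiseDisjoint fun t => (V : Set G) * {t} :=
  hD.subset fun _ ht => ((mem_tilesIn hV).1 ht).2

/-- A point of `U` whose tile is not contained in `U` exits `U` under some `b a⁻¹` with `a, b ∈ V`.
-/
theorem card_le_card_tilesIn_add {V : Finset G} {D : Set G} (hV : V.Nonempty)
    (hD : (⋃ t ∈ D, (V : Set G) * {t}) = Set.univ) (U : Finset G) :
    U.card ≤ (tilesIn V U D).card * V.card + ∑ i ∈ V ×ˢ V, exitCount (i.1 * i.2⁻¹) U := by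
  classical
  have h : U ⊆ (tilesIn V U D ×ˢ V).image (fun i => i.2 * i.1) ∪
      (V ×ˢ V).biUnion fun i => U.filter fun y => i.1 * i.2⁻¹ * y ∉ U := by
    intro y hy
    have hy' : y ∈ ⋃ t ∈ D, (V : Set G) * {t} := hD ▸ Set.mem_univ y
    simp only [Set.mem_iUnion, Set.mul_singleton, Set.mem_image, Finset.mem_coe] at hy'
    obtain ⟨t, ht, a, ha, rfl⟩ := hy'
    by_cases h : ∃ b ∈ V, b * t ∉ U
    · obtain ⟨b, hb, hbt⟩ := h
      refine Finset.mem_union_right _ (Finset.mem_biUnion.2 ⟨(b, a),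
        Finset.mem_product.2 ⟨hb, ha⟩, Finset.mem_filter.2 ⟨hy, ?_⟩⟩)
      simpa [mul_assoc] using hbt
    · push Not at h
      exact Finset.mem_union_left _ (Finset.mem_image.2 ⟨(t, a),
        Finset.mem_product.2 ⟨(mem_tilesIn hV).2 ⟨h, ht⟩, ha⟩, rfl⟩)
  refine (Finset.card_le_card h).trans ((Finset.card_union_le _ _).trans ?_)
  exact Nat.add_le_add (Finset.card_image_le.trans (Finset.card_product _ _).le)
    Finset.card_biUnion_le

theorem IsFolner.tendsto_card_tilesIn {Q : ℕ → Finset G} (hQ : IsFolner Q)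
    (hne : ∀ n, (Q n).Nonempty) {V : Finset G} (hV : V.Nonempty) {D : Set G}
    (hdisj : D.PairwiseDisjoint fun t => (V : Set G) * {t})
    (hD : (⋃ t ∈ D, (V : Set G) * {t}) = Set.univ) :
    Tendsto (fun j => ((tilesIn V (Q j) D).card * V.card : ℝ) / (Q j).card) atTop (𝓝 1) := by
  have hpos : ∀ n, (0 : ℝ) < (Q n).card := fun n => by exact_mod_cast (hne n).card_pos
  have h0 : Tendsto (fun n => 1 - ∑ i ∈ V ×ˢ V, (exitCount (i.1 * i.2⁻¹) (Q n) : ℝ) / (Q n).card)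
      atTop (𝓝 1) := by
    simpa using (tendsto_finsetSum (V ×ˢ V) fun i _ =>
      hQ.tendsto_exitCount (i.1 * i.2⁻¹)).const_sub 1
  refine tendsto_of_tendsto_of_tendsto_of_le_of_le h0 tendsto_const_nhds (fun n => ?_) fun n => ?_
  · rw [← Finset.sum_div, le_div_iff₀ (hpos n), sub_mul, div_mul_cancel₀ _ (hpos n).ne', one_mul,
      sub_le_iff_le_add]
    exact_mod_cast card_le_card_tilesIn_add hV hD (Q n)
  · refine (div_le_one (hpos n)).2 ?_
    exact_mod_cast card_mul_card_le (pairwiseDisjoint_tilesIn hV hdisj)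
      fun t ht => ((mem_tilesIn hV).1 ht).1

theorem finite_open_crossingEdges {V T U : Finset G} {ω : Config G}
    (hω : ∀ x : G, ((percolationGraph ω).neighborSet x).Finite) :
    {e ∈ crossingEdges V T U | ω e = true}.Finite := by
  have h : (⋃ x ∈ U, (fun y => s(x, y)) '' (percolationGraph ω).neighborSet x).Finite :=
    U.finite_toSet.biUnion fun x _ => (hω x).image _
  refine Set.Finite.of_finite_image (f := Subtype.val) (h.subset ?_) Subtype.val_injective.injOn
  rintro _ ⟨⟨e, he⟩, ⟨⟨⟨x, hxU, y, rfl⟩, -⟩, heω⟩, rfl⟩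
  exact Set.mem_biUnion hxU ⟨y, ⟨he, heω⟩, rfl⟩

theorem EdgeParameter.ae_eventually_card_open_lt [Countable G] (P : EdgeParameter G)
    {Q : ℕ → Finset G} (hQ : IsFolner Q) (hcard : ∀ n, n < (Q n).card) {V : Finset G}
    (hV : V.Nonempty) {D : Set G} (hdisj : D.PairwiseDisjoint fun t => (V : Set G) * {t})
    (hD : (⋃ t ∈ D, (V : Set G) * {t}) = Set.univ) {δ : ℝ} (hδ : 0 < δ)
    (hb : P.boundaryWeight V / V.card ≤ δ) :
    ∀ᵐ ω ∂P.measure, ∀ᶠ j in atTop, ∀ F : Finset (Edge G),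
      (F : Set (Edge G)) ⊆ crossingEdges V (tilesIn V (Q j) D) (Q j) →
      ((F.filter fun e => ω e = true).card : ℝ) < 5 * δ * (Q j).card := by
  have hne : ∀ n, (Q n).Nonempty := fun n => Finset.card_pos.1 ((Nat.zero_le n).trans_lt (hcard n))
  have hpos : ∀ n, (0 : ℝ) < (Q n).card := fun n => by exact_mod_cast (hne n).card_pos
  have hVpos : (0 : ℝ) < V.card := by exact_mod_cast hV.card_pos
  set p₁ := ∑' g, P.p g
  have hlim : Tendsto (fun j => (1 - ((tilesIn V (Q j) D).card * V.card : ℝ) / (Q j).card) * p₁)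
      atTop (𝓝 0) := by
    simpa using ((hQ.tendsto_card_tilesIn hne hV hdisj hD).const_sub 1).mul_const p₁
  have hB := ae_eventually_notMem_of_le_exp (μ := P.measure) (C := 1) (c := δ) zero_le_one hδ
    (B := fun j => {ω | ∃ F : Finset (Edge G),
      (F : Set (Edge G)) ⊆ crossingEdges V (tilesIn V (Q j) D) (Q j) ∧
      5 * δ * (Q j).card ≤ ((F.filter fun e => ω e = true).card : ℝ)}) ?_
  · filter_upwards [hB] with ω hω
    filter_upwards [hω] with j hj F hF
    by_contra h
    exact hj ⟨F, hF, not_lt.1 h⟩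
  filter_upwards [hlim.eventually_le_const hδ] with j hj
  have hTU : ∀ t ∈ tilesIn V (Q j) D, ∀ a ∈ V, a * t ∈ Q j := fun t ht =>
    ((mem_tilesIn hV).1 ht).1
  have hT := pairwiseDisjoint_tilesIn (U := Q j) hV hdisj
  have hmean : ∀ F : Finset (Edge G),
      (F : Set (Edge G)) ⊆ crossingEdges V (tilesIn V (Q j) D) (Q j) →
      ∑ e ∈ F, (P.prob e.1 : ℝ) ≤ 2 * δ * (Q j).card := by
    intro F hF
    refine (P.sum_prob_crossingEdges_le hT hTU F hF).trans ?_
    have h1 : ((tilesIn V (Q j) D).card : ℝ) * V.card ≤ (Q j).card := by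
      exact_mod_cast card_mul_card_le hT hTU
    have h2 : P.boundaryWeight V ≤ δ * V.card := (div_le_iff₀ hVpos).1 hb
    have h3 : ((tilesIn V (Q j) D).card : ℝ) * P.boundaryWeight V ≤ δ * (Q j).card := by
      calc ((tilesIn V (Q j) D).card : ℝ) * P.boundaryWeight V
          ≤ (tilesIn V (Q j) D).card * (δ * V.card) := by gcongr
        _ = δ * ((tilesIn V (Q j) D).card * V.card) := by ring
        _ ≤ δ * (Q j).card := by gcongr
    have h4 : ((Q j).card - (tilesIn V (Q j) D).card * V.card : ℝ) * p₁ ≤ δ * (Q j).card := by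
      have := mul_le_mul_of_nonneg_right hj (hpos j).le
      refine le_trans (le_of_eq ?_) this
      have := (hpos j).ne'
      field_simp
    linarith
  -- With mean at most `2δ|Q j|` and threshold `5δ|Q j|`, the Chernoff exponent is `4δ|Q j| - 5δ|Q
  -- j| = -δ|Q j| ≤ -δj`.
  refine (P.measure_exists_card_open_ge_le _ hmean _).trans (ENNReal.ofReal_le_ofReal ?_)
  rw [one_mul, Real.exp_le_exp]
  have : (j : ℝ) ≤ (Q j).card := by exact_mod_cast (hcard j).le
  nlinarith

open Classical in
theorem sum_finiteCount_tilePattern {V : Finset G} (T : Finset G) (ω : Config G) (E : ℝ) :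
    ∑ t : T, (finiteCount (tilePattern V (percolationGraph ω) t) E : ℝ) =
      ∑ S : SimpleGraph V, ((T.filter fun t => ω ∈ patternEvent S t).card : ℝ) *
        finiteCount S E := by
  rw [Finset.sum_coe_sort T fun t => (finiteCount (tilePattern V (percolationGraph ω) t) E : ℝ),
    ← Finset.sum_fiberwise_of_maps_to (g := fun t => tilePattern V (percolationGraph ω) t)
      (t := Finset.univ) fun _ _ => Finset.mem_univ _]
  refine Finset.sum_congr rfl fun S _ => ?_
  simp only [mem_patternEvent_iff]
  rw [← nsmul_eq_mul, ← Finset.sum_const]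
  exact Finset.sum_congr rfl fun t ht => by rw [(Finset.mem_filter.1 ht).2]

-- The tiles are already disjoint, so no colouring is needed. The limit carries the factor `1 / |V|`
-- because there are about `|Q j| / |V|` tiles.
open Classical in
theorem EdgeParameter.ae_tendsto_tile_frequency (P : EdgeParameter G)
    {Q : ℕ → Finset G} (hQ : IsFolner Q) (hcard : ∀ n, n < (Q n).card) {V : Finset G}
    (hV : V.Nonempty) {D : Set G} (hdisj : D.PairwiseDisjoint fun t => (V : Set G) * {t})
    (hD : (⋃ t ∈ D, (V : Set G) * {t}) = Set.univ) (S : SimpleGraph V) :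
    ∀ᵐ ω ∂P.measure, Tendsto (fun j =>
      (((tilesIn V (Q j) D).filter fun t => ω ∈ patternEvent S t).card : ℝ) / (Q j).card)
      atTop (𝓝 (P.frequency S / V.card)) := by
  have hne : ∀ n, (Q n).Nonempty := fun n => Finset.card_pos.1 ((Nat.zero_le n).trans_lt (hcard n))
  have hVpos : (V.card : ℝ) ≠ 0 := by exact_mod_cast hV.card_pos.ne'
  have hsub : ∀ j, ((translatesIn V (Q j)).subtype (· ∈ D)).card = (tilesIn V (Q j) D).card :=
    fun j => Finset.card_subtype _ _
  filter_upwards [P.ae_tendsto_pattern_sub S hdisj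
    (fun j => (translatesIn V (Q j)).subtype (· ∈ D)) (fun j => (Q j).card)
    (fun j => (hsub j).le.trans
      ((Finset.card_filter_le _ _).trans (card_translatesIn_le hV))) hcard] with ω hω
  have h2 := hω.add (((hQ.tendsto_card_tilesIn hne hV hdisj hD).div_const (V.card : ℝ)).const_mul
    (P.frequency S))
  rw [zero_add, mul_one_div] at h2
  refine h2.congr fun j => ?_
  have hfil : (((translatesIn V (Q j)).subtype (· ∈ D)).filter
      fun t : D => ω ∈ patternEvent S (t : G)).card =
      ((tilesIn V (Q j) D).filter fun t => ω ∈ patternEvent S t).card := by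
    refine (card_filter_subtype (translatesIn V (Q j)) (· ∈ D)
      fun x => ω ∈ patternEvent S x).trans ?_
    rw [Finset.filter_comm]
    rfl
  rw [hsub, hfil]
  field_simp
  ring

theorem EdgeParameter.ae_eventually_abs_sub_patternSum_le [Countable G] (P : EdgeParameter G)
    {Q : ℕ → Finset G} (hQ : IsFolner Q) (hcard : ∀ n, n < (Q n).card) {V : Finset G}
    (hV : V.Nonempty) (hmono : IsMonotile V) {δ : ℝ} (hδ : 0 < δ)
    (hb : P.boundaryWeight V / V.card ≤ δ) :
    ∀ᵐ ω ∂P.measure, ∀ᶠ j in atTop, ∀ E : ℝ,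
      |(restrictedCount (percolationGraph ω) (Q j) E : ℝ) / (Q j).card - P.patternSum V E| ≤
        7 * δ := by
  classical
  obtain ⟨D, hdisj, hD⟩ := hmono
  have hne : ∀ n, (Q n).Nonempty := fun n => Finset.card_pos.1 ((Nat.zero_le n).trans_lt (hcard n))
  have hpos : ∀ n, (0 : ℝ) < (Q n).card := fun n => by exact_mod_cast (hne n).card_pos
  have hVpos : (0 : ℝ) < V.card := by exact_mod_cast hV.card_pos
  filter_upwards [P.ae_finite_neighborSet,
    P.ae_eventually_card_open_lt hQ hcard hV hdisj hD hδ hb,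
    ae_all_iff.2 fun S => P.ae_tendsto_tile_frequency hQ hcard hV hdisj hD S] with ω hfin hC hfreq
  have hlim1 : Tendsto (fun j => 1 - ((tilesIn V (Q j) D).card * V.card : ℝ) / (Q j).card)
      atTop (𝓝 0) := by
    simpa using (hQ.tendsto_card_tilesIn hne hV hdisj hD).const_sub 1
  -- A finite sum over patterns, weighted by the bound `|V|` for each `finiteCount`; the later
  -- estimate is thereby uniform in `E`.
  have hlim2 : Tendsto (fun j => ∑ S : SimpleGraph V,
      |(((tilesIn V (Q j) D).filter fun t => ω ∈ patternEvent S t).card : ℝ) / (Q j).card -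
        P.frequency S / V.card| * V.card) atTop (𝓝 0) := by
    have := tendsto_finsetSum (Finset.univ : Finset (SimpleGraph V)) fun S _ =>
      (((hfreq S).sub_const (P.frequency S / V.card)).abs.mul_const (V.card : ℝ))
    simpa using this
  filter_upwards [hC, hlim1.eventually_le_const hδ, hlim2.eventually_le_const hδ] with j hj h1 h2 E
  have hTU : ∀ t ∈ tilesIn V (Q j) D, ∀ a ∈ V, a * t ∈ Q j := fun t ht =>
    ((mem_tilesIn hV).1 ht).1
  have hT := pairwiseDisjoint_tilesIn (U := Q j) hV hdisj
  set T := tilesIn V (Q j) D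
  have hfinC := finite_open_crossingEdges (V := V) (T := T) (U := Q j) hfin
  have hCmem : ∀ e ∈ crossingEdges V T (Q j), e.1 ∈ (percolationGraph ω).edgeSet →
      e ∈ hfinC.toFinset := by
    rintro ⟨e, he⟩ hcr hadj
    rw [Set.Finite.mem_toFinset]
    refine ⟨hcr, ?_⟩
    induction e with | _ x y
    exact hadj.2
  have hcardC : (hfinC.toFinset.card : ℝ) < 5 * δ * (Q j).card := by
    have h := hj hfinC.toFinset fun e he => ((Set.Finite.mem_toFinset _).1 he).1
    rwa [Finset.filter_true_of_mem fun e he => ((Set.Finite.mem_toFinset _).1 he).2] at h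
  have hlow := sum_finiteCount_le (percolationGraph ω) hfin hT hTU hCmem E
  have hupp := restrictedCount_add_le (percolationGraph ω) hfin hT hTU hCmem E
  set s : ℝ := ∑ t : T, (finiteCount (tilePattern V (percolationGraph ω) t) E : ℝ) with hs
  have hlow' : s ≤ restrictedCount (percolationGraph ω) (Q j) E + hfinC.toFinset.card := by
    rw [hs]
    exact_mod_cast hlow
  have hupp' : (restrictedCount (percolationGraph ω) (Q j) E : ℝ) + T.card * V.card ≤
      s + (Q j).card + hfinC.toFinset.card := by
    rw [hs]
    exact_mod_cast hupp
  have hle : ((Q j).card : ℝ) - T.card * V.card ≤ δ * (Q j).card := by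
    have := mul_le_mul_of_nonneg_right h1 (hpos j).le
    rwa [sub_mul, div_mul_cancel₀ _ (hpos j).ne', one_mul] at this
  -- The bound `6δ` consists of `5δ` for open crossing edges and `δ` for points outside the tiles.
  have hstep1 : |(restrictedCount (percolationGraph ω) (Q j) E : ℝ) / (Q j).card -
      s / (Q j).card| ≤ 6 * δ := by
    rw [← sub_div, abs_div, abs_of_pos (hpos j), div_le_iff₀ (hpos j), abs_le]
    have := mul_pos hδ (hpos j)
    constructor <;> linarith
  have hstep2 : |s / (Q j).card - P.patternSum V E| ≤ δ := by
    refine le_trans ?_ h2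
    rw [hs, sum_finiteCount_tilePattern, Finset.sum_div, EdgeParameter.patternSum,
      ← Finset.sum_sub_distrib]
    refine (Finset.abs_sum_le_sum_abs _ _).trans (Finset.sum_le_sum fun S _ => ?_)
    have : ((T.filter fun t => ω ∈ patternEvent S t).card : ℝ) * finiteCount S E / (Q j).card -
        P.frequency S * (finiteCount S E / V.card) =
        (((T.filter fun t => ω ∈ patternEvent S t).card : ℝ) / (Q j).card -
          P.frequency S / V.card) * finiteCount S E := by ring
    rw [this, abs_mul, Nat.abs_cast]
    gcongr
    exact (finiteCount_le S E).trans_eq (Fintype.card_coe V)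
  calc _ ≤ |(restrictedCount (percolationGraph ω) (Q j) E : ℝ) / (Q j).card - s / (Q j).card| +
        |s / (Q j).card - P.patternSum V E| := abs_sub_le _ _ _
    _ ≤ 7 * δ := by linarith

end Comparison

/-! ### The integrated density of states -/

/-- No convergence of `f` is assumed: `u n` and `u m` are both close to one `f j` with `j` large, so
`u` is uniformly Cauchy, and `f` then follows its limit. -/
theorem exists_tendstoUniformly_of_eventually_abs_sub_le {α : Type*} {f u : ℕ → α → ℝ}
    (h : ∀ ε > 0, ∀ᶠ n in atTop, ∀ᶠ j in atTop, ∀ x, |f j x - u n x| ≤ ε) :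
    ∃ N : α → ℝ, TendstoUniformly f N atTop ∧ TendstoUniformly u N atTop := by
  have hcauchy : ∀ ε > 0, ∃ n₀, ∀ n ≥ n₀, ∀ m ≥ n₀, ∀ x, |u n x - u m x| ≤ ε := by
    intro ε hε
    obtain ⟨n₀, hn₀⟩ := eventually_atTop.1 (h (ε / 2) (half_pos hε))
    refine ⟨n₀, fun n hn m hm x => ?_⟩
    obtain ⟨j, hj, hj'⟩ := ((hn₀ n hn).and (hn₀ m hm)).exists
    have h1 := abs_le.1 (hj x)
    have h2 := abs_le.1 (hj' x)
    rw [abs_le]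
    constructor <;> linarith
  have hlim : ∀ x, ∃ l, Tendsto (fun n => u n x) atTop (𝓝 l) := by
    intro x
    refine cauchySeq_tendsto_of_complete (Metric.cauchySeq_iff.2 fun ε hε => ?_)
    obtain ⟨n₀, hn₀⟩ := hcauchy (ε / 2) (half_pos hε)
    exact ⟨n₀, fun n hn m hm => (hn₀ n hn m hm x).trans_lt (half_lt_self hε)⟩
  choose N hN using hlim
  have hu : ∀ ε > 0, ∀ᶠ n in atTop, ∀ x, |u n x - N x| ≤ ε := by
    intro ε hε
    obtain ⟨n₀, hn₀⟩ := hcauchy ε hε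
    filter_upwards [eventually_ge_atTop n₀] with n hn x
    refine le_of_tendsto ((hN x).const_sub (u n x)).abs ?_
    filter_upwards [eventually_ge_atTop n₀] with m hm using hn₀ n hn m hm x
  refine ⟨N, Metric.tendstoUniformly_iff.2 fun ε hε => ?_,
    Metric.tendstoUniformly_iff.2 fun ε hε => ?_⟩
  · obtain ⟨n, hn, hn'⟩ := ((h (ε / 3) (by positivity)).and (hu (ε / 3) (by positivity))).exists
    filter_upwards [hn] with j hj x
    rw [dist_comm, Real.dist_eq]
    have h1 := abs_le.1 (hj x)
    have h2 := abs_le.1 (hn' x)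
    rw [abs_lt]
    constructor <;> linarith
  · filter_upwards [hu (ε / 2) (half_pos hε)] with n hn x
    rw [dist_comm]
    exact (hn x).trans_lt (half_lt_self hε)

section RestrictedCount

variable {G : Type*} (Γ : SimpleGraph G) {Q : ℕ → Finset G} {N : ℝ → ℝ}

theorem monotone_of_tendstoUniformly_restrictedCount
    (h : TendstoUniformly (fun j E => (restrictedCount Γ (Q j) E : ℝ) / (Q j).card) N atTop) :
    Monotone N := by
  intro E E' hE
  refine le_of_tendsto_of_tendsto' (h.tendsto_at E) (h.tendsto_at E') fun j => ?_
  gcongr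
  exact eigenvalueCount_mono _ _ hE

theorem continuousWithinAt_of_tendstoUniformly_restrictedCount
    (h : TendstoUniformly (fun j E => (restrictedCount Γ (Q j) E : ℝ) / (Q j).card) N atTop)
    (E : ℝ) : ContinuousWithinAt N (Set.Ici E) E := by
  refine h.tendsto_of_eventually_tendsto (Eventually.of_forall fun j => ?_) (h.tendsto_at E)
  refine tendsto_const_nhds.congr' ?_
  filter_upwards [eventually_eigenvalueCount_eq _ (restrictedLaplacian_isSymmetric Γ (Q j)) E]
    with x hx
  simp only [restrictedCount, hx]

theorem tendsto_atBot_of_tendstoUniformly_restrictedCount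
    (h : TendstoUniformly (fun j E => (restrictedCount Γ (Q j) E : ℝ) / (Q j).card) N atTop) :
    Tendsto N atBot (𝓝 0) := by
  refine h.tendsto_of_eventually_tendsto (L := fun _ => 0) (Eventually.of_forall fun j => ?_)
    tendsto_const_nhds
  refine tendsto_const_nhds.congr' ?_
  filter_upwards [eventually_atBot_eigenvalueCount_eq _ (restrictedLaplacian_isSymmetric Γ (Q j))]
    with x hx
  simp [restrictedCount, hx]

theorem tendsto_atTop_of_tendstoUniformly_restrictedCount (hne : ∀ n, (Q n).Nonempty)
    (h : TendstoUniformly (fun j E => (restrictedCount Γ (Q j) E : ℝ) / (Q j).card) N atTop) :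
    Tendsto N atTop (𝓝 1) := by
  refine h.tendsto_of_eventually_tendsto (L := fun _ => 1) (Eventually.of_forall fun j => ?_)
    tendsto_const_nhds
  refine tendsto_const_nhds.congr' ?_
  filter_upwards [eventually_atTop_eigenvalueCount_eq _ (restrictedLaplacian_isSymmetric Γ (Q j))]
    with x hx
  have : ((Q j).card : ℝ) ≠ 0 := by exact_mod_cast (hne j).card_pos.ne'
  simp [restrictedCount, hx, this]

end RestrictedCount

theorem IsMonotile.nonempty {G : Type*} [Group G] {V : Finset G} (h : IsMonotile V) :
    V.Nonempty := by
  obtain ⟨D, -, hD⟩ := h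
  by_contra hV
  rw [Finset.not_nonempty_iff_eq_empty] at hV
  have h1 : (1 : G) ∈ ⋃ t ∈ D, (V : Set G) * {t} := hD ▸ Set.mem_univ _
  simp [hV] at h1

theorem EdgeParameter.ae_eventually_abs_sub_patternSum_le_of_folner {G : Type*} [Group G]
    [Countable G] (P : EdgeParameter G) {Q : ℕ → Finset G} (hQ : IsFolner Q)
    (hcard : ∀ n, n < (Q n).card) (hmono : ∀ n, IsMonotile (Q n)) :
    ∀ᵐ ω ∂P.measure, ∀ ε > 0, ∀ᶠ n in atTop, ∀ᶠ j in atTop, ∀ E : ℝ,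
      |(restrictedCount (percolationGraph ω) (Q j) E : ℝ) / (Q j).card - P.patternSum (Q n) E| ≤
        ε := by
  have key : ∀ k : ℕ, ∀ᵐ ω ∂P.measure, ∀ n,
      P.boundaryWeight (Q n) / (Q n).card ≤ 1 / ((k : ℝ) + 1) → ∀ᶠ j in atTop, ∀ E : ℝ,
      |(restrictedCount (percolationGraph ω) (Q j) E : ℝ) / (Q j).card - P.patternSum (Q n) E| ≤
        7 * (1 / ((k : ℝ) + 1)) := by
    intro k
    refine ae_all_iff.2 fun n => ?_
    by_cases hb : P.boundaryWeight (Q n) / (Q n).card ≤ 1 / ((k : ℝ) + 1)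
    · filter_upwards [P.ae_eventually_abs_sub_patternSum_le hQ hcard (hmono n).nonempty (hmono n)
        (by positivity) hb] with ω hω _ using hω
    · exact ae_of_all _ fun ω h => absurd h hb
  filter_upwards [ae_all_iff.2 key] with ω hω ε hε
  obtain ⟨k, hk⟩ := exists_nat_one_div_lt (show 0 < ε / 7 by positivity)
  have hk0 : (0 : ℝ) < 1 / ((k : ℝ) + 1) := by positivity
  filter_upwards [(hQ.tendsto_boundaryWeight P).eventually_le_const hk0] with n hn
  filter_upwards [hω k n hn] with j hj E
  exact (hj E).trans (by linarith)

end LongRangePercolation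

end

open LongRangePercolation in
theorem theorem4 {G : Type*} [Group G] [Group.FG G] (P : EdgeParameter G)
    (Q : ℕ → Finset G) (hfolner : IsFolner Q) (htempered : IsTempered Q)
    (hincr : ∀ n, (Q n).card < (Q (n + 1)).card) (hmono : ∀ n, IsMonotile (Q n)) :
    ∃ N : StieltjesFunction ℝ,
      Tendsto N atBot (𝓝 0) ∧ Tendsto N atTop (𝓝 1) ∧
      (∀ᵐ ω ∂P.measure,
        (∀ x : G, ((percolationGraph ω).neighborSet x).Finite) ∧
        (∀ V : Finset G, V.Nonempty → ∀ S : SimpleGraph V,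
          Tendsto (fun j => (occurrences S (percolationGraph ω) (Q j) : ℝ) / ((Q j).card : ℝ))
            atTop (𝓝 (P.frequency S))) ∧
        TendstoUniformly
          (fun j E => (restrictedCount (percolationGraph ω) (Q j) E : ℝ) / ((Q j).card : ℝ))
          N atTop) ∧
      TendstoUniformly (fun n E => P.patternSum (Q n) E) N atTop := by
  have : Countable G := countable_of_fg
  -- This growth makes bounds of the form `exp (-c |Q j|)` summable in `j`.
  have hcard : ∀ n, n < (Q n).card := by
    intro n
    induction n with
    | zero => exact (hmono 0).nonempty.card_pos
    | succ n ih => exact (Nat.succ_le_of_lt ih).trans_lt (hincr n)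
  have hae := P.ae_eventually_abs_sub_patternSum_le_of_folner hfolner hcard hmono
  -- A single good configuration suffices to define `N`.
  obtain ⟨ω₀, hω₀⟩ := hae.exists
  obtain ⟨N, hfN, huN⟩ := exists_tendstoUniformly_of_eventually_abs_sub_le hω₀
  refine ⟨⟨N, monotone_of_tendstoUniformly_restrictedCount _ hfN,
    continuousWithinAt_of_tendstoUniformly_restrictedCount _ hfN⟩,
    tendsto_atBot_of_tendstoUniformly_restrictedCount _ hfN,
    tendsto_atTop_of_tendstoUniformly_restrictedCount _ (fun n => (hmono n).nonempty) hfN,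
    ?_, huN⟩
  have hocc : ∀ᵐ ω ∂P.measure, ∀ V : Finset G, V.Nonempty → ∀ S : SimpleGraph V,
      Tendsto (fun j => (occurrences S (percolationGraph ω) (Q j) : ℝ) / ((Q j).card : ℝ))
        atTop (𝓝 (P.frequency S)) := by
    refine ae_all_iff.2 fun V => ?_
    by_cases hV : V.Nonempty
    · filter_upwards [ae_all_iff.2 fun S => hfolner.ae_tendsto_occurrences hcard P hV S]
        with ω hω _ using hω
    · exact ae_of_all _ fun ω h => absurd h hV
  filter_upwards [P.ae_finite_neighborSet, hocc, hae] with ω h1 h2 h3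
  refine ⟨h1, h2, ?_⟩
  obtain ⟨N', hfN', huN'⟩ := exists_tendstoUniformly_of_eventually_abs_sub_le h3
  -- For any other good configuration the limit is also the limit of the nonrandom `patternSum`,
  -- hence the same function.
  obtain rfl : N' = N := funext fun E =>
    tendsto_nhds_unique (huN'.tendsto_at E) (huN.tendsto_at E)
  exact hfN'
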